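/- Let $K\subset\mathbb{R}^n$ be a compact convex set whose interior contains the origin, with gauge function $\gamma(x)=\gamma_K(x)=\inf\{\lambda>0:\ x/\lambda\in K\}$ and polar $K^\circ=\{x:\langle x,y\rangle\le 1\text{ for all }y\in K\}$, and let $\gamma^\circ=\gamma_{K^\circ}$. For $z\in\partial K$ let $N(K,z)=\{v:\langle w-z,v\rangle\le 0\text{ for all }w\in K\}$ be the normal cone. Let $U\subset\mathbb{R}^n$ be a bounded open set, let $$\rho(x)=d_K(x,\partial U)=\min_{y\in\partial U}\gamma_K(x-y),$$ and call $y\in\partial U$ a $\rho$-closest point to $x$ if $\rho(x)=\gamma(x-y)$. Define the signed extension $$\rho_s(x)=\begin{cases}\rho(x), & x\in\overline U,\\ -d_{-K}(x,\partial U), & x\in\mathbb{R}^n\setminus\overline U.\end{cases}$$ Suppose $\partial U$ is $C^{k,\alpha}$ with an integer $k\ge1$ and $0\le\alpha\le1$ (locally $U$ is one side of a regular $C^{k,\alpha}$ hypersurface), and let $\nu$ be the inward unit normal to $\partial U$. Let $y_0\in\partial U$ be the unique $\rho$-closest point on $\partial U$ to some $x_0\in U$, and suppose that $\nu(y_0)$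 is an interior point of the normal cone $N\big(K,\frac{x_0-y_0}{\rho(x_0)}\big)$. Then there is an open ball $B_r(y_0)$ with the following properties. 1. $\rho_s$ is $C^{k,\alpha}$ on $B_r(y_0)$, and $\rho$ is $C^{k,\alpha}$ on $\overline U\cap B_r(y_0)$. 2. Every $y\in\partial U\cap B_r(y_0)$ is the unique $\rho$-closest point on $\partial U$ to some point of $U$. 3. For every $y\in\partial U\cap B_r(y_0)$, the derivative of $\rho$ at $y$ relative to $\overline U$ is $$D\rho(y)=\frac{\nu(y)}{\gamma^\circ(\nu(y))}.$$ 4. Suppose $k\ge2$, and let $d(x)=\min_{z\in\partial U}|x-z|$ be the Euclidean distance to $\partial U$. Then $d$ is $C^2$ on $\overline U\cap B_r(y_0)$, and for every $y\in\partial U\cap B_r(y_0)$, with $\nu=\nu(y)$, the function $\gamma^\circ$ is differentiable at $\nu$ and $$D^2\rho(y)=\frac{1}{\gamma^\circ(\nu)}\,(I-X^T)\,D^2d(y)\,(I-X),\qquad X=\frac{1}{\gamma^\circ(\nu)}\,D\gamma^\circ(\nu)\otimes\nu,$$ where $(a\otimes b)z=\langle z,b\rangle a$ and the derivatives at $y$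 are taken relative to $\overline U$. Moreover, whenever $y$ is the unique $\rho$-closest point on $\partial U$ to a point $x\in U$, the function $\rho$ is $C^2$ near every point of the segment $[x,y]$ (relative to $\overline U$), and $D^2\rho(z)=D^2\rho(y)$ for all $z\in[x,y]$; in particular $D^2\rho(x)$ is given by the same formula. -/

import Mathlib

open Set Filter Topology
open scoped NNReal Pointwise Gradient

noncomputable section

namespace MinkowskiDistance

variable {n : ℕ}

/-- The (one-sided) polar `K° = {x : ⟨x, y⟩ ≤ 1 for all y ∈ K}`. -/
def polarBody (K : Set (EuclideanSpace ℝ (Fin n))) : Set (EuclideanSpace ℝ (Fin n)) :=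
  {x | ∀ y ∈ K, inner ℝ x y ≤ 1}

/-- The gauge function `γ°` of the polar `K°`. (The gauge `γ` of `K` itself is `gauge K`.) -/
def polarGauge (K : Set (EuclideanSpace ℝ (Fin n))) : EuclideanSpace ℝ (Fin n) → ℝ :=
  gauge (polarBody K)

/-- The normal cone `N(K, x)`: zero together with all outer normal vectors of `K` at `x`. -/
def normalCone (K : Set (EuclideanSpace ℝ (Fin n))) (x : EuclideanSpace ℝ (Fin n)) :
    Set (EuclideanSpace ℝ (Fin n)) :=
  {v | ∀ y ∈ K, inner ℝ (y - x) v ≤ 0}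

/-- The distance `d_K(x, ∂U) = min_{y ∈ ∂U} γ_K (x - y)` to the boundary of `U`. -/
def dist (K U : Set (EuclideanSpace ℝ (Fin n))) (x : EuclideanSpace ℝ (Fin n)) : ℝ :=
  sInf ((fun y => gauge K (x - y)) '' frontier U)

/-- The signed extension of `d_K(·, ∂U)`: outside the closure of `U` it is minus the distance
to `∂U` with respect to the reflected body `-K`. -/
def signedDist (K U : Set (EuclideanSpace ℝ (Fin n))) (x : EuclideanSpace ℝ (Fin n)) : ℝ :=
  open Classical in if x ∈ closure U then dist K U x else -dist (-K) U x

/-- `y` is the unique closest point to `x` on `∂U`, with respect to `d_K`. -/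
def IsUniqueClosest (K U : Set (EuclideanSpace ℝ (Fin n))) (x y : EuclideanSpace ℝ (Fin n)) :
    Prop :=
  y ∈ frontier U ∧ gauge K (x - y) = dist K U x ∧
    ∀ z ∈ frontier U, gauge K (x - z) = dist K U x → z = y

/-- `f` is of class `C^{k,α}` on `S`: it is `C^k` on `S`, and its `k`-th derivative is Hölder
continuous with exponent `α` on `S`. -/
def IsCkHolderOn (k : ℕ) (α : ℝ≥0) (f : EuclideanSpace ℝ (Fin n) → ℝ)
    (S : Set (EuclideanSpace ℝ (Fin n))) : Prop :=
  ContDiffOn ℝ k f S ∧ ∃ C : ℝ≥0, HolderOnWith C α (iteratedFDerivWithin ℝ k f S) S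

/-- `∂U` is of class `C^{k,α}` (`k ≥ 1`): near each boundary point, `U` is one side of the
regular zero level set of a `C^{k,α}` function. -/
def HasCkHolderBoundary (k : ℕ) (α : ℝ≥0) (U : Set (EuclideanSpace ℝ (Fin n))) : Prop :=
  ∀ y ∈ frontier U, ∃ (N : Set (EuclideanSpace ℝ (Fin n))) (φ : EuclideanSpace ℝ (Fin n) → ℝ),
    IsOpen N ∧ y ∈ N ∧ IsCkHolderOn k α φ N ∧ (∀ x ∈ N, fderiv ℝ φ x ≠ 0) ∧
      U ∩ N = {x ∈ N | 0 < φ x}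

/-- `v` is the inward unit normal to `∂U` at `y`: a unit vector such that rays from `y` making an
acute angle with `v` start inside `U`, and rays making an obtuse angle with `v` start in the
exterior of `U`. At a boundary point of a `C¹` domain there is exactly one such `v`. -/
def IsInwardUnitNormal (U : Set (EuclideanSpace ℝ (Fin n))) (y v : EuclideanSpace ℝ (Fin n)) :
    Prop :=
  ‖v‖ = 1 ∧ ∀ w : EuclideanSpace ℝ (Fin n),
    (0 < inner ℝ w v → ∀ᶠ t : ℝ in 𝓝[>] 0, y + t • w ∈ U) ∧
    (inner ℝ w v < 0 → ∀ᶠ t : ℝ in 𝓝[>] 0, y + t • w ∉ closure U)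

/-- The second derivative of `f` at `x` relative to `S`, as the linear map `D(Df)(x)`. It is the
usual second derivative when `x` is an interior point of `S`. -/
def hessWithin (f : EuclideanSpace ℝ (Fin n) → ℝ) (S : Set (EuclideanSpace ℝ (Fin n)))
    (x : EuclideanSpace ℝ (Fin n)) : EuclideanSpace ℝ (Fin n) →L[ℝ] EuclideanSpace ℝ (Fin n) :=
  fderivWithin ℝ (fun z => gradientWithin f S z) S x

/-- The projection `X(v) = (1 / γ°(v)) Dγ°(v) ⊗ v`, where `(a ⊗ b) z = ⟨z, b⟩ a`. -/
def projX (K : Set (EuclideanSpace ℝ (Fin n))) (v : EuclideanSpace ℝ (Fin n)) :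
    EuclideanSpace ℝ (Fin n) →L[ℝ] EuclideanSpace ℝ (Fin n) :=
  (1 / polarGauge K v) • InnerProductSpace.rankOne ℝ (∇ (polarGauge K) v) v

end MinkowskiDistance

end

/-!
Let `a = (x₀ - y₀) / ρ(x₀)`, a boundary point of `K` at which `ν(y₀)` is an interior normal. The
whole theorem rests on the fact that near `y₀` the signed distance of `y + t a`, for `y ∈ ∂U`,
equals `t` (`eventually_signedDist_eq`). Indeed, if a boundary point `w` is at most as far from
`y + t a` as `y` is, then `⟨y - w, u⟩ ≤ 0` for every `u` in the normal cone `N(K, a)`, because every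
such `u` attains the support function of `K` at `a`. As `ν(y₀)` is interior to this cone,
`⟨y - w, ν(y₀)⟩ ≤ -δ |y - w|` for a fixed `δ > 0`. This is incompatible with a `C¹` boundary, whose
chords become tangent to it near `y₀`, unless `w = y` (`eventually_eq_of_polar_cone`).

So the signed distance is the implicit function `τ` with `φ(x - τ(x) a) = 0`, for a local defining
function `φ` of `U`. Its gradient is a smooth function of `∇φ` at the projection `p(x) = x - τ(x) a`,
so it inherits the class `C^{k,α}` one order at a time (`CkHolderAt.implicit`), and expressing `∇φ`
through the normal gives `∇ρ_s(x) = ν(p(x)) / ⟨a, ν(p(x))⟩` (`ckHolderAt_signedDist`). On the normal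
cone at `a` the function `γ°` is the linear form `⟨a, ·⟩`, which identifies `⟨a, ν⟩` with `γ°(ν)`
and `a` with `Dγ°(ν)`.

For `k ≥ 2`, the Euclidean distance has a `C²` extension `d` with `∇d = ν` on the boundary, obtained
from the local inverse of `(q, t) ↦ (q + t N(q), φ(q))` with `N = ∇φ / |∇φ|`
(`exists_contDiffAt_eq_infDist`). Hence `∇ρ_s = ∇d ∘ p / ⟨a, ∇d ∘ p⟩`, and differentiating this
identity at a boundary point gives the formula for the second derivative.

If `y` near `y₀` is the unique closest point to `x ∈ U`, then every point `z ≠ y` of the segment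
`[x, y]` has the same unique closest point. By compactness, closest points of points near `z` are
near `y`, and they are left in the same direction `a`, since the normal there is still interior to
`N(K, a)`. So near `z` the distance is a translate of the signed distance near `y`
(`IsUniqueClosest.eventually_dist_eq`).
-/

/-! ### Functions of class `C^{k,α}` near a point -/

namespace MinkowskiDistance

universe u

/-- `f` is of class `C^{k,α}` near `x`: it is `C^k` at `x`, and its `k`-th derivative is Hölder
continuous with exponent `α` on some neighbourhood of `x`. -/
def CkHolderAt {E F : Type*} [NormedAddCommGroup E] [NormedSpace ℝ E]
    [NormedAddCommGroup F] [NormedSpace ℝ F] (k : ℕ) (α : ℝ≥0) (f : E → F) (x : E) : Prop :=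
  ContDiffAt ℝ k f x ∧ ∃ C : ℝ≥0, ∃ s ∈ 𝓝 x, HolderOnWith C α (iteratedFDeriv ℝ k f) s

namespace CkHolderAt

section Calculus

variable {E F G : Type u} [NormedAddCommGroup E] [NormedSpace ℝ E]
  [NormedAddCommGroup F] [NormedSpace ℝ F] [NormedAddCommGroup G] [NormedSpace ℝ G]
  {k : ℕ} {α : ℝ≥0} {f g : E → F} {x : E}

theorem congr (hf : CkHolderAt k α f x) (h : g =ᶠ[𝓝 x] f) : CkHolderAt k α g x := by
  obtain ⟨hc, C, s, hs, hC⟩ := hf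
  refine ⟨hc.congr_of_eventuallyEq h, C, _, inter_mem hs (h.iteratedFDeriv ℝ k), ?_⟩
  rintro y ⟨hy, hy'⟩ z ⟨hz, hz'⟩
  rw [mem_ofPred_eq] at hy' hz'
  rw [hy', hz']
  exact hC y hy z hz

/-- A `C¹` function is locally Lipschitz, hence locally Hölder with every exponent `α ≤ 1`. -/
theorem _root_.ContDiffAt.exists_holderOnWith (hf : ContDiffAt ℝ 1 f x) (hα : α ≤ 1) :
    ∃ C : ℝ≥0, ∃ s ∈ 𝓝 x, HolderOnWith C α f s := by
  obtain ⟨K, t, ht, hK⟩ := hf.exists_lipschitzOnWith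
  obtain ⟨ε, hε, hball⟩ := Metric.mem_nhds_iff.1 ht
  have h1 : HolderOnWith K 1 f (Metric.ball x ε) := holderOnWith_one.2 (hK.mono hball)
  have hd : ∀ y ∈ Metric.ball x ε, ∀ z ∈ Metric.ball x ε,
      edist y z ≤ ((2 * ε.toNNReal : ℝ≥0) : ENNReal) := by
    intro y hy z hz
    have h2 : edist y z ≤ ENNReal.ofReal (2 * ε) := by
      rw [edist_dist]
      apply ENNReal.ofReal_le_ofReal
      have := dist_triangle_right y z x
      rw [Metric.mem_ball] at hy hz
      linarith
    refine h2.trans (le_of_eq ?_)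
    rw [ENNReal.ofReal, Real.toNNReal_mul (by norm_num)]
    simp
  exact ⟨_, _, Metric.ball_mem_nhds x hε, h1.of_le hd hα⟩

theorem of_contDiffAt (hf : ContDiffAt ℝ (k + 1) f x) (hα : α ≤ 1) : CkHolderAt k α f x := by
  refine ⟨hf.of_le (by exact_mod_cast Nat.le_succ k), ?_⟩
  apply ContDiffAt.exists_holderOnWith _ hα
  exact hf.iteratedFDeriv_right (by rw [add_comm])

theorem of_succ (hf : CkHolderAt (k + 1) α f x) (hα : α ≤ 1) : CkHolderAt k α f x :=
  of_contDiffAt (by exact_mod_cast hf.1) hα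

/-- A function is `C^{k+1,α}` exactly when it is differentiable with a `C^{k,α}` derivative. -/
theorem succ_iff : CkHolderAt (k + 1) α f x ↔
    (∀ᶠ y in 𝓝 x, DifferentiableAt ℝ f y) ∧ CkHolderAt k α (fderiv ℝ f) x := by
  have key : ∀ y z, edist (iteratedFDeriv ℝ (k + 1) f y) (iteratedFDeriv ℝ (k + 1) f z) =
      edist (iteratedFDeriv ℝ k (fderiv ℝ f) y) (iteratedFDeriv ℝ k (fderiv ℝ f) z) := by
    intro y z
    simp only [iteratedFDeriv_succ_eq_comp_right, Function.comp_apply,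
      LinearIsometryEquiv.edist_map]
  have h2 : (∃ C : ℝ≥0, ∃ s ∈ 𝓝 x, HolderOnWith C α (iteratedFDeriv ℝ (k + 1) f) s) ↔
      ∃ C : ℝ≥0, ∃ s ∈ 𝓝 x, HolderOnWith C α (iteratedFDeriv ℝ k (fderiv ℝ f)) s := by
    simp only [HolderOnWith, key]
  unfold CkHolderAt
  rw [h2, ← and_assoc, and_congr_left_iff]
  intro _
  constructor
  · intro h
    have h' : ContDiffAt ℝ ((k : WithTop ℕ∞) + 1) f x := by exact_mod_cast h
    refine ⟨?_, h'.fderiv_right_succ⟩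
    filter_upwards [(h'.of_le (m := 1) (by simp)).eventually (by simp)] with y hy
    exact hy.differentiableAt (by simp)
  · rintro ⟨hd, hc⟩
    have : ContDiffAt ℝ ((k : WithTop ℕ∞) + 1) f x :=
      contDiffAt_succ_iff_hasFDerivAt.2 ⟨fderiv ℝ f, ⟨_, hd, fun y hy => hy.hasFDerivAt⟩, hc⟩
    exact_mod_cast this

theorem zero_iff : CkHolderAt 0 α f x ↔
    ContDiffAt ℝ 0 f x ∧ ∃ C : ℝ≥0, ∃ s ∈ 𝓝 x, HolderOnWith C α f s := by
  have key : ∀ y z, edist (iteratedFDeriv ℝ 0 f y) (iteratedFDeriv ℝ 0 f z) =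
      edist (f y) (f z) := by
    intro y z
    rw [iteratedFDeriv_zero_eq_comp, Function.comp_apply, Function.comp_apply,
      LinearIsometryEquiv.edist_map]
  unfold CkHolderAt
  simp only [HolderOnWith, key, Nat.cast_zero]

theorem prodMk {g : E → G} (hf : CkHolderAt k α f x) (hg : CkHolderAt k α g x) :
    CkHolderAt k α (fun y => (f y, g y)) x := by
  obtain ⟨hfc, C, s, hs, hC⟩ := hf
  obtain ⟨hgc, D, t, ht, hD⟩ := hg
  refine ⟨hfc.prodMk hgc, max C D, s ∩ t ∩ {y | ContDiffAt ℝ k f y ∧ ContDiffAt ℝ k g y}, ?_, ?_⟩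
  · exact inter_mem (inter_mem hs ht) ((hfc.eventually (by simp)).and (hgc.eventually (by simp)))
  · rintro y ⟨⟨hy1, hy2⟩, hy3, hy4⟩ z ⟨⟨hz1, hz2⟩, hz3, hz4⟩
    rw [iteratedFDeriv_prodMk hy3 hy4 le_rfl, iteratedFDeriv_prodMk hz3 hz4 le_rfl]
    have e : ∀ (a b : ContinuousMultilinearMap ℝ (fun _ : Fin k => E) F)
        (c d : ContinuousMultilinearMap ℝ (fun _ : Fin k => E) G),
        edist (a.prod c) (b.prod d) = max (edist a b) (edist c d) := by
      intro a b c d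
      rw [← Prod.edist_eq (a, c) (b, d)]
      exact (ContinuousMultilinearMap.prodL ℝ (fun _ : Fin k => E) F G).edist_map (a, c) (b, d)
    rw [e]
    refine max_le ((hC y hy1 z hz1).trans ?_) ((hD y hy2 z hz2).trans ?_)
    · gcongr; simp
    · gcongr; simp

/-- Composition on the left with a smoother function. By the chain rule the derivative is the
bilinear composition applied to a pair of `C^{k-1,α}` functions, which is the same statement one
order lower. -/
theorem smooth_comp {g : F → G} (hg : ContDiffAt ℝ (k + 1) g (f x)) (hf : CkHolderAt k α f x)
    (hα : α ≤ 1) : CkHolderAt k α (fun y => g (f y)) x := by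
  induction k generalizing F G with
  | zero =>
    obtain ⟨hfc, C, s, hs, hC⟩ := zero_iff.1 hf
    have hg1 : ContDiffAt ℝ 1 g (f x) := by simpa using hg
    obtain ⟨K, t, ht, hK⟩ := hg1.exists_lipschitzOnWith
    refine zero_iff.2 ⟨(hg1.of_le (by simp)).comp x hfc, K * C ^ ((1 : ℝ≥0) : ℝ),
      s ∩ f ⁻¹' t, inter_mem hs (hfc.continuousAt ht), ?_⟩
    have := (holderOnWith_one.2 hK).comp (hC.mono (inter_subset_left (t := f ⁻¹' t)))
      (fun y hy => hy.2)
    simpa using! this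
  | succ k ih =>
    have hg' : ContDiffAt ℝ ((k : WithTop ℕ∞) + 1) (fderiv ℝ g) (f x) := by
      apply hg.fderiv_right; simp
    have hg1 : ∀ᶠ z in 𝓝 (f x), DifferentiableAt ℝ g z := by
      filter_upwards [(hg.of_le (m := 1) (by simp)).eventually (by simp)] with z hz
      exact hz.differentiableAt (by simp)
    have hg1' := hf.1.continuousAt.eventually hg1
    obtain ⟨hfd, hf'⟩ := succ_iff.1 hf
    refine succ_iff.2 ⟨?_, ?_⟩
    · filter_upwards [hg1', hfd] with y h1 h2 using h1.comp y h2
    · have hpair := (ih hg' (hf.of_succ hα)).prodMk hf'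
      have hcomp : ContDiff ℝ ((k : WithTop ℕ∞) + 1)
          (fun p : (F →L[ℝ] G) × (E →L[ℝ] F) => p.1.comp p.2) :=
        contDiff_fst.clm_comp contDiff_snd
      refine (ih hcomp.contDiffAt hpair).congr ?_
      filter_upwards [hg1', hfd] with y h1 h2 using fderiv_comp y h1 h2

/-- Composition of `C^{k,α}` functions. For `k = 0` the inner function has to be locally
Lipschitz. -/
theorem comp {g : F → G} (hg : CkHolderAt k α g (f x)) (hf : CkHolderAt k α f x)
    (hf1 : ContDiffAt ℝ 1 f x) (hα : α ≤ 1) : CkHolderAt k α (fun y => g (f y)) x := by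
  induction k generalizing G with
  | zero =>
    obtain ⟨hgc, C, t, ht, hC⟩ := zero_iff.1 hg
    obtain ⟨K, s, hs, hK⟩ := hf1.exists_lipschitzOnWith
    refine zero_iff.2 ⟨hgc.comp x hf.1, C * K ^ (α : ℝ), s ∩ f ⁻¹' t,
      inter_mem hs (hf1.continuousAt ht), ?_⟩
    have := hC.comp ((holderOnWith_one.2 hK).mono (inter_subset_left (t := f ⁻¹' t)))
      (fun y hy => hy.2)
    simpa using! this
  | succ k ih =>
    obtain ⟨hgd, hg'⟩ := succ_iff.1 hg
    have hgd' := hf.1.continuousAt.eventually hgd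
    obtain ⟨hfd, hf'⟩ := succ_iff.1 hf
    refine succ_iff.2 ⟨?_, ?_⟩
    · filter_upwards [hgd', hfd] with y h1 h2 using h1.comp y h2
    · have hpair := (ih hg' (hf.of_succ hα)).prodMk hf'
      have hcomp : ContDiff ℝ ((k : WithTop ℕ∞) + 1)
          (fun p : (F →L[ℝ] G) × (E →L[ℝ] F) => p.1.comp p.2) :=
        contDiff_fst.clm_comp contDiff_snd
      refine (smooth_comp hcomp.contDiffAt hpair hα).congr ?_
      filter_upwards [hgd', hfd] with y h1 h2 using fderiv_comp y h1 h2

end Calculus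

/-- Regularity of implicit functions. If `τ` is `C¹` and `φ (y - τ y • a) = 0` near `x`, where
`φ` is of class `C^{k,α}` with nonvanishing derivative in the direction `a`, then `τ` is as regular
as `φ`: its derivative is a smooth function of the derivative of `φ` along the projection
`y ↦ y - τ y • a`, so the regularity improves by one order at a time. -/
theorem implicit {E : Type} [NormedAddCommGroup E] [NormedSpace ℝ E] {k : ℕ} {α : ℝ≥0}
    {φ τ : E → ℝ} {x a : E} (hα : α ≤ 1) (hk : 1 ≤ k)
    (hφ : CkHolderAt k α φ (x - τ x • a)) (ha : fderiv ℝ φ (x - τ x • a) a ≠ 0)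
    (hτ : ContDiffAt ℝ 1 τ x)
    (hτ' : ∀ᶠ y in 𝓝 x, fderiv ℝ τ y =
      (fderiv ℝ φ (y - τ y • a) a)⁻¹ • fderiv ℝ φ (y - τ y • a)) :
    CkHolderAt k α τ x := by
  have hτd : ∀ᶠ y in 𝓝 x, DifferentiableAt ℝ τ y := by
    filter_upwards [hτ.eventually (by simp)] with y hy using hy.differentiableAt (by simp)
  have hp1 : ContDiffAt ℝ 1 (fun y => y - τ y • a) x :=
    contDiffAt_id.sub (hτ.smul contDiffAt_const)
  have hG : ∀ m : ℕ, ContDiffAt ℝ (m + 1) (fun L : E →L[ℝ] ℝ => (L a)⁻¹ • L)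
      (fderiv ℝ φ (x - τ x • a)) := by
    intro m
    have h1 : ContDiffAt ℝ (m + 1) (fun L : E →L[ℝ] ℝ => L a) (fderiv ℝ φ (x - τ x • a)) :=
      contDiffAt_id.clm_apply contDiffAt_const
    exact (h1.inv ha).smul contDiffAt_id
  -- one step of the bootstrap
  have step : ∀ m : ℕ, CkHolderAt m α (fderiv ℝ φ) (x - τ x • a) →
      CkHolderAt m α (fun y => y - τ y • a) x → CkHolderAt (m + 1) α τ x := by
    intro m h1 h2
    refine succ_iff.2 ⟨hτd, CkHolderAt.congr ?_ hτ'⟩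
    exact smooth_comp (g := fun L : E →L[ℝ] ℝ => (L a)⁻¹ • L) (hG m) (comp h1 h2 hp1 hα) hα
  obtain ⟨m, rfl⟩ : ∃ m, k = m + 1 := ⟨k - 1, by omega⟩
  clear hk
  induction m with
  | zero =>
    refine step 0 (succ_iff.1 hφ).2 (of_contDiffAt ?_ hα)
    simpa using! hp1
  | succ m ih =>
    refine step (m + 1) (succ_iff.1 hφ).2 ?_
    have h1 : CkHolderAt (m + 1) α τ x := ih (hφ.of_succ hα)
    have h2 : CkHolderAt (m + 1) α (fun y => (y, τ y)) x :=
      (of_contDiffAt contDiffAt_id hα).prodMk h1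
    exact smooth_comp (g := fun p : E × ℝ => p.1 - p.2 • a)
      (contDiff_fst.sub (contDiff_snd.smul contDiff_const)).contDiffAt h2 hα

end CkHolderAt

/-! ### Local defining functions and the inward normal -/

section Defining

/-- A real function increases to first order along every ray on which its derivative is
positive. -/
theorem eventually_lt_of_fderiv_pos {E : Type*} [NormedAddCommGroup E] [NormedSpace ℝ E]
    {φ : E → ℝ} {y w : E} (hφ : DifferentiableAt ℝ φ y) (hw : 0 < fderiv ℝ φ y w) :
    ∀ᶠ t : ℝ in 𝓝[>] 0, φ y < φ (y + t • w) := by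
  have h1 : HasDerivAt (fun t : ℝ => y + t • w) w 0 := by
    simpa using ((hasDerivAt_id (0 : ℝ)).smul_const w).const_add y
  have h2 : HasDerivAt (fun t : ℝ => φ (y + t • w)) (fderiv ℝ φ y w) 0 := by
    have h3 : HasFDerivAt φ (fderiv ℝ φ y) (y + (0 : ℝ) • w) := by
      simpa using hφ.hasFDerivAt
    exact h3.comp_hasDerivAt 0 h1
  have h4 := (hasDerivAt_iff_tendsto_slope.1 h2).eventually (eventually_gt_nhds hw)
  have h5 : 𝓝[>] (0 : ℝ) ≤ 𝓝[≠] 0 := nhdsWithin_mono _ (fun t ht => ne_of_gt ht)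
  filter_upwards [h5 h4, self_mem_nhdsWithin] with t ht ht0
  rw [mem_Ioi] at ht0
  rw [slope_def_field, sub_zero] at ht
  have := (div_pos_iff_of_pos_right ht0).1 ht
  simpa using this

/-- `φ` is a local defining function of `U` at the boundary point `y`: it is `C¹` with
nonvanishing derivative at `y`, and near `y` it is positive on `U`, zero on the boundary of `U`
and negative outside. -/
structure IsDefiningAt {E : Type*} [NormedAddCommGroup E] [NormedSpace ℝ E]
    (U : Set E) (φ : E → ℝ) (y : E) : Prop where
  contDiffAt : ContDiffAt ℝ 1 φ y
  eq_zero : φ y = 0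
  fderiv_ne : fderiv ℝ φ y ≠ 0
  mem_iff : ∀ᶠ x in 𝓝 y, (x ∈ U ↔ 0 < φ x)
  closure_iff : ∀ᶠ x in 𝓝 y, (x ∈ closure U ↔ 0 ≤ φ x)
  frontier_iff : ∀ᶠ x in 𝓝 y, (x ∈ frontier U ↔ φ x = 0)

theorem IsDefiningAt.eventually {E : Type*} [NormedAddCommGroup E] [NormedSpace ℝ E]
    {U : Set E} {φ : E → ℝ} {y : E} (h : IsDefiningAt U φ y) :
    ∀ᶠ x in 𝓝 y, x ∈ frontier U → IsDefiningAt U φ x := by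
  have h1 : ContinuousAt (fderiv ℝ φ) y :=
    (h.contDiffAt.fderiv_right (m := 0) (by simp)).continuousAt
  filter_upwards [h.contDiffAt.eventually (by simp), h1.eventually_ne h.fderiv_ne,
    h.mem_iff.eventually_nhds, h.closure_iff.eventually_nhds, h.frontier_iff.eventually_nhds]
    with x a b c d e hx
  exact ⟨a, e.self_of_nhds.1 hx, b, c, d, e⟩

variable {n : ℕ} {U : Set (EuclideanSpace ℝ (Fin n))} {φ : EuclideanSpace ℝ (Fin n) → ℝ}
  {y v : EuclideanSpace ℝ (Fin n)} {k : ℕ} {α : ℝ≥0}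

theorem inner_gradient_eq (φ : EuclideanSpace ℝ (Fin n) → ℝ) (y w : EuclideanSpace ℝ (Fin n)) :
    inner ℝ (∇ φ y) w = fderiv ℝ φ y w := inner_gradient_left

theorem gradient_ne_zero_iff : ∇ φ y ≠ 0 ↔ fderiv ℝ φ y ≠ 0 := by
  simp [gradient]

theorem _root_.ContDiffAt.gradient {m l : WithTop ℕ∞} (h : ContDiffAt ℝ l φ y) (hm : m + 1 ≤ l) :
    ContDiffAt ℝ m (∇ φ) y :=
  (InnerProductSpace.toDual ℝ (EuclideanSpace ℝ (Fin n))).symm.contDiff.contDiffAt.comp y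
    (h.fderiv_right hm)

theorem exists_isDefiningAt (hUopen : IsOpen U) (hk : 1 ≤ k) (hU : HasCkHolderBoundary k α U)
    (hy : y ∈ frontier U) : ∃ φ, CkHolderAt k α φ y ∧ IsDefiningAt U φ y := by
  obtain ⟨N, φ, hN, hyN, ⟨hφ, C, hC⟩, hne, hUN⟩ := hU y hy
  have hmem : ∀ x ∈ N, (x ∈ U ↔ 0 < φ x) := by
    intro x hx
    have : x ∈ U ∩ N ↔ x ∈ {x ∈ N | 0 < φ x} := by rw [hUN]
    simpa [hx] using this
  have hdiff : ∀ x ∈ N, ContDiffAt ℝ k φ x := fun x hx => (hφ x hx).contDiffAt (hN.mem_nhds hx)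
  have hk1 : (1 : WithTop ℕ∞) ≤ k := by exact_mod_cast hk
  have hclos : ∀ x ∈ N, (x ∈ closure U ↔ 0 ≤ φ x) := by
    intro x hx
    have hdx : DifferentiableAt ℝ φ x := ((hdiff x hx).of_le hk1).differentiableAt (by simp)
    constructor
    · intro hxc
      by_contra! hlt
      have h1 : ∀ᶠ z in 𝓝 x, z ∉ U := by
        filter_upwards [hN.mem_nhds hx, hdx.continuousAt.eventually (eventually_lt_nhds hlt)]
          with z hz hz'
        rw [hmem z hz]
        exact hz'.le.not_gt
      exact (mem_closure_iff_frequently.1 hxc) h1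
    · intro h0
      obtain ⟨w, hw⟩ : ∃ w, 0 < fderiv ℝ φ x w := by
        refine ⟨∇ φ x, ?_⟩
        rw [← inner_gradient_eq, real_inner_self_eq_norm_sq]
        have := norm_pos_iff.2 (gradient_ne_zero_iff.2 (hne x hx))
        positivity
      have h1 := eventually_lt_of_fderiv_pos hdx hw
      have h2 : Tendsto (fun t : ℝ => x + t • w) (𝓝[>] 0) (𝓝 x) := by
        have : Continuous (fun t : ℝ => x + t • w) := by fun_prop
        have h3 := this.tendsto 0
        simp only [zero_smul, add_zero] at h3
        exact h3.mono_left nhdsWithin_le_nhds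
      refine mem_closure_of_tendsto h2 ?_
      filter_upwards [h1, h2 (hN.mem_nhds hx)] with t ht ht'
      exact (hmem _ ht').2 (h0.trans_lt ht)
  have hfr : ∀ x ∈ N, (x ∈ frontier U ↔ φ x = 0) := by
    intro x hx
    rw [hUopen.frontier_eq, Set.mem_sdiff, hclos x hx, hmem x hx, not_lt, and_comm, le_antisymm_iff]
  have hN' := hN.mem_nhds hyN
  refine ⟨φ, ⟨hdiff y hyN, C, N, hN', ?_⟩, (hdiff y hyN).of_le hk1, (hfr y hyN).1 hy, hne y hyN,
    mem_of_superset hN' hmem, mem_of_superset hN' hclos, mem_of_superset hN' hfr⟩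
  intro a ha b hb
  rw [← iteratedFDerivWithin_of_isOpen k hN ha, ← iteratedFDerivWithin_of_isOpen k hN hb]
  exact hC a ha b hb

/-- A unit vector `u` for which rays making an acute angle with `u` start in the closure of `U` is
the inward unit normal: otherwise the ray in the direction `u - v` contradicts the definition of
the normal `v`. -/
theorem IsInwardUnitNormal.eq_of_forall_ray (hv : IsInwardUnitNormal U y v)
    {u : EuclideanSpace ℝ (Fin n)} (hu : ‖u‖ = 1)
    (h : ∀ w, 0 < inner ℝ w u → ∀ᶠ t : ℝ in 𝓝[>] 0, y + t • w ∈ closure U) : u = v := by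
  by_contra hne
  have h1 : inner ℝ u v < 1 := by
    refine lt_of_le_of_ne (by simpa [hu, hv.1] using real_inner_le_norm u v) ?_
    rwa [Ne, inner_eq_one_iff_of_norm_eq_one hu hv.1]
  have h2 : 0 < inner ℝ (u - v) u := by
    rw [inner_sub_left, real_inner_self_eq_norm_sq, hu, real_inner_comm]; linarith
  have h3 : inner ℝ (u - v) v < 0 := by
    rw [inner_sub_left, real_inner_self_eq_norm_sq, hv.1]; linarith
  obtain ⟨t, ht, ht'⟩ := ((h _ h2).and ((hv.2 _).2 h3)).exists
  exact ht' ht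

theorem IsDefiningAt.eventually_mem (h : IsDefiningAt U φ y) {w : EuclideanSpace ℝ (Fin n)}
    (hw : 0 < fderiv ℝ φ y w) : ∀ᶠ t : ℝ in 𝓝[>] 0, y + t • w ∈ U := by
  have h2 : Tendsto (fun t : ℝ => y + t • w) (𝓝[>] 0) (𝓝 y) := by
    have : Continuous (fun t : ℝ => y + t • w) := by fun_prop
    have h3 := this.tendsto 0
    simp only [zero_smul, add_zero] at h3
    exact h3.mono_left nhdsWithin_le_nhds
  filter_upwards [eventually_lt_of_fderiv_pos (h.contDiffAt.differentiableAt (by simp)) hw,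
    h2.eventually h.mem_iff] with t ht ht'
  rwa [ht', ← h.eq_zero]

theorem IsDefiningAt.normal_eq (h : IsDefiningAt U φ y) (hv : IsInwardUnitNormal U y v) :
    v = ‖∇ φ y‖⁻¹ • ∇ φ y := by
  have hg : ∇ φ y ≠ 0 := gradient_ne_zero_iff.2 h.fderiv_ne
  refine (hv.eq_of_forall_ray (norm_smul_inv_norm (𝕜 := ℝ) hg) fun w hw => ?_).symm
  refine (h.eventually_mem ?_).mono fun t ht => subset_closure ht
  rw [← inner_gradient_eq, real_inner_comm]
  have hg' : 0 < ‖∇ φ y‖ := norm_pos_iff.2 hg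
  rw [real_inner_smul_right] at hw
  exact (pos_iff_pos_of_mul_pos hw).1 (inv_pos.2 hg')

theorem IsDefiningAt.norm_gradient_pos (h : IsDefiningAt U φ y) : 0 < ‖∇ φ y‖ :=
  norm_pos_iff.2 (gradient_ne_zero_iff.2 h.fderiv_ne)

theorem IsDefiningAt.fderiv_apply (h : IsDefiningAt U φ y) (hv : IsInwardUnitNormal U y v)
    (w : EuclideanSpace ℝ (Fin n)) : fderiv ℝ φ y w = ‖∇ φ y‖ * inner ℝ v w := by
  rw [h.normal_eq hv, real_inner_smul_left, inner_gradient_eq,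
    mul_inv_cancel_left₀ h.norm_gradient_pos.ne']

/-- The closure of `U` has unique derivatives at a boundary point with an inward normal, because
its tangent cone there contains an open half-space. -/
theorem IsInwardUnitNormal.uniqueDiffWithinAt (hy : y ∈ frontier U)
    (hv : IsInwardUnitNormal U y v) : UniqueDiffWithinAt ℝ (closure U) y := by
  refine ⟨?_, subset_closure (frontier_subset_closure hy)⟩
  have h1 : {w : EuclideanSpace ℝ (Fin n) | 0 < inner ℝ w v} ⊆ tangentConeAt ℝ (closure U) y := by
    intro w hw
    refine mem_tangentConeAt_of_add_smul_mem (c := fun t : ℝ => t) (l := 𝓝[>] 0) ?_ ?_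
    · exact tendsto_id.mono_left (nhdsWithin_mono _ fun t ht => ne_of_gt ht)
    · exact ((hv.2 w).1 hw).mono fun t ht => subset_closure ht
  have h2 : IsOpen {w : EuclideanSpace ℝ (Fin n) | 0 < inner ℝ w v} :=
    isOpen_lt continuous_const (by fun_prop)
  have h3 : v ∈ {w : EuclideanSpace ℝ (Fin n) | 0 < inner ℝ w v} := by
    simp [hv.1]
  have h4 : Submodule.span ℝ (tangentConeAt ℝ (closure U) y) = ⊤ := by
    apply Submodule.eq_top_of_nonempty_interior'
    exact ⟨v, interior_mono Submodule.subset_span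
      (interior_mono h1 (h2.interior_eq.symm ▸ h3))⟩
  rw [h4]
  exact dense_univ

theorem uniqueDiffOn_closure (hUopen : IsOpen U)
    {ν : EuclideanSpace ℝ (Fin n) → EuclideanSpace ℝ (Fin n)}
    (hν : ∀ y ∈ frontier U, IsInwardUnitNormal U y (ν y)) : UniqueDiffOn ℝ (closure U) := by
  intro x hx
  by_cases h : x ∈ U
  · exact uniqueDiffWithinAt_of_mem_nhds (mem_of_superset (hUopen.mem_nhds h) subset_closure)
  · have : x ∈ frontier U := by rw [hUopen.frontier_eq]; exact ⟨hx, h⟩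
    exact (hν x this).uniqueDiffWithinAt this

end Defining

/-! ### The implicit function of a level set in a transversal direction -/

section Implicit

variable {E : Type} [NormedAddCommGroup E] [NormedSpace ℝ E]
  {φ : E → ℝ} {y a : E} {k : ℕ} {α : ℝ≥0}

/-- A level set that is transversal to `a` at `y` is locally reached from every point `x` by moving
along `-a` for a time `τ x`, and `τ` is as regular as the defining function. -/
theorem exists_implicit [CompleteSpace E] (hα : α ≤ 1) (hk : 1 ≤ k) (hφ : CkHolderAt k α φ y)
    (h0 : φ y = 0) (ha : fderiv ℝ φ y a ≠ 0) :
    ∃ τ : E → ℝ, τ y = 0 ∧ CkHolderAt k α τ y ∧ (∀ᶠ x in 𝓝 y, φ (x - τ x • a) = 0) ∧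
      ∀ᶠ x in 𝓝 y, HasFDerivAt τ ((fderiv ℝ φ (x - τ x • a) a)⁻¹ • fderiv ℝ φ (x - τ x • a)) x := by
  have hφ1 : ContDiffAt ℝ 1 φ y := hφ.1.of_le (by exact_mod_cast hk)
  set f : E × ℝ → ℝ := fun p => φ (p.1 - p.2 • a) with hf
  have hline : ContDiff ℝ 1 (fun p : E × ℝ => p.1 - p.2 • a) :=
    contDiff_fst.sub (contDiff_snd.smul contDiff_const)
  have hfc : ContDiffAt ℝ 1 f (y, 0) := by
    refine ContDiffAt.comp (g := φ) (y, (0 : ℝ)) ?_ hline.contDiffAt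
    simpa using hφ1
  have hf2 : fderiv ℝ f (y, 0) ∘L .inr ℝ E ℝ =
      ContinuousLinearEquiv.unitsEquivAut ℝ (Units.mk0 (-fderiv ℝ φ y a) (neg_ne_zero.2 ha)) := by
    ext
    have h1 : HasFDerivAt (fun p : E × ℝ => p.1 - p.2 • a)
        (ContinuousLinearMap.fst ℝ E ℝ - (ContinuousLinearMap.snd ℝ E ℝ).smulRight a) (y, 0) :=
      hasFDerivAt_fst.sub (hasFDerivAt_snd.smul_const a)
    have h2 : HasFDerivAt φ (fderiv ℝ φ y) ((y, (0 : ℝ)).1 - (y, (0 : ℝ)).2 • a) := by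
      simpa using (hφ1.differentiableAt (by simp)).hasFDerivAt
    have h3 := (h2.comp (y, (0 : ℝ)) h1).fderiv
    rw [show f = φ ∘ fun p : E × ℝ => p.1 - p.2 • a from rfl, h3]
    simp
  have hinv : (fderiv ℝ f (y, 0) ∘L .inr ℝ E ℝ).IsInvertible := by
    rw [hf2]; exact ContinuousLinearMap.isInvertible_equiv
  set τ := hfc.implicitFunction one_ne_zero hinv
  have hτ0 : τ y = 0 := hfc.implicitFunction_apply_self one_ne_zero hinv
  have hτc : ContDiffAt ℝ 1 τ y := hfc.contDiffAt_implicitFunction one_ne_zero hinv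
  have hτ : ∀ᶠ x in 𝓝 y, φ (x - τ x • a) = 0 := by
    filter_upwards [hfc.eventually_apply_implicitFunction one_ne_zero hinv] with x hx
    simpa [hf, h0] using hx
  have hp : Tendsto (fun x => x - τ x • a) (𝓝 y) (𝓝 y) := by
    have : ContinuousAt (fun x => x - τ x • a) y :=
      continuousAt_id.sub (hτc.continuousAt.smul continuousAt_const)
    simpa [ContinuousAt, hτ0] using this
  have hcont : ContinuousAt (fun x => fderiv ℝ φ x a) y :=
    ((hφ1.fderiv_right (m := 0) (by simp)).continuousAt).clm_apply continuousAt_const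
  have hD : ∀ᶠ x in 𝓝 y, HasFDerivAt τ
      ((fderiv ℝ φ (x - τ x • a) a)⁻¹ • fderiv ℝ φ (x - τ x • a)) x := by
    filter_upwards [hτ.eventually_nhds, hτc.eventually (by simp),
      hp.eventually (hφ1.eventually (by simp)), hp.eventually (hcont.eventually_ne ha)]
      with x h1 h2 h3 h4
    have hτx := (h2.differentiableAt (by simp)).hasFDerivAt
    have h5 : HasFDerivAt (fun x => x - τ x • a)
        (ContinuousLinearMap.id ℝ E - (fderiv ℝ τ x).smulRight a) x :=
      (hasFDerivAt_id x).sub (hτx.smul_const a)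
    have h6 := (h3.differentiableAt (by simp)).hasFDerivAt.comp x h5
    have h7 : HasFDerivAt (φ ∘ fun x => x - τ x • a) (0 : E →L[ℝ] ℝ) x :=
      (hasFDerivAt_const (0 : ℝ) x).congr_of_eventuallyEq h1
    have h8 := h6.unique h7
    suffices h10 : (fderiv ℝ φ (x - τ x • a) a)⁻¹ • fderiv ℝ φ (x - τ x • a) = fderiv ℝ τ x by
      rwa [h10]
    refine ContinuousLinearMap.ext fun w => ?_
    have h9 := congrArg (fun L : E →L[ℝ] ℝ => L w) h8
    simp only [ContinuousLinearMap.comp_apply, sub_apply,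
      ContinuousLinearMap.id_apply, ContinuousLinearMap.smulRight_apply, map_sub, map_smul,
      zero_apply, smul_eq_mul] at h9
    simp only [smul_apply, smul_eq_mul]
    field_simp
    linarith
  refine ⟨τ, hτ0, ?_, hτ, hD⟩
  refine CkHolderAt.implicit (φ := φ) (a := a) hα hk ?_ ?_ hτc (hD.mono fun x hx => hx.fderiv)
  · simpa [hτ0] using hφ
  · simpa [hτ0] using ha

end Implicit

/-! ### Convex bodies, gauges and normal cones -/

/-- `K` is a compact convex set with the origin in its interior. -/
structure IsBody {n : ℕ} (K : Set (EuclideanSpace ℝ (Fin n))) : Prop where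
  isCompact : IsCompact K
  convex : Convex ℝ K
  zero_mem : (0 : EuclideanSpace ℝ (Fin n)) ∈ interior K

section Body

variable {n : ℕ} {K U : Set (EuclideanSpace ℝ (Fin n))} {a v x y : EuclideanSpace ℝ (Fin n)}

namespace IsBody

theorem mem_nhds (hK : IsBody K) : K ∈ 𝓝 0 := mem_interior_iff_mem_nhds.1 hK.zero_mem

theorem continuous_gauge (hK : IsBody K) : Continuous (gauge K) :=
  _root_.continuous_gauge hK.convex hK.mem_nhds

theorem gauge_le_one_iff (hK : IsBody K) : gauge K x ≤ 1 ↔ x ∈ K := by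
  rw [gauge_le_one_iff_mem_closure hK.convex hK.mem_nhds, hK.isCompact.isClosed.closure_eq]

theorem gauge_pos_iff (hK : IsBody K) : 0 < gauge K x ↔ x ≠ 0 :=
  gauge_pos (absorbent_nhds_zero hK.mem_nhds)
    ((NormedSpace.isVonNBounded_iff ℝ).2 hK.isCompact.isBounded)

theorem gauge_add_le (hK : IsBody K) (x y : EuclideanSpace ℝ (Fin n)) :
    gauge K (x + y) ≤ gauge K x + gauge K y :=
  _root_.gauge_add_le hK.convex (absorbent_nhds_zero hK.mem_nhds) x y

theorem exists_norm_le (hK : IsBody K) : ∃ R : ℝ, 0 < R ∧ ∀ x, ‖x‖ ≤ R * gauge K x := by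
  obtain ⟨R, hR, hKR⟩ := hK.isCompact.isBounded.subset_closedBall_lt 0 0
  refine ⟨R, hR, fun x => ?_⟩
  have := le_gauge_of_subset_closedBall (x := x) (absorbent_nhds_zero hK.mem_nhds) hR.le hKR
  rwa [div_le_iff₀' hR] at this

theorem inv_gauge_smul (hK : IsBody K) (hx : x ≠ 0) : gauge K ((gauge K x)⁻¹ • x) = 1 := by
  have h := hK.gauge_pos_iff.2 hx
  rw [gauge_smul_of_nonneg (inv_nonneg.2 h.le), smul_eq_mul, inv_mul_cancel₀ h.ne']

/-- Vectors of the normal cone at `a` attain the support function of `K` at `a`. -/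
theorem inner_le_of_mem_normalCone (hK : IsBody K) (hv : v ∈ normalCone K a)
    (x : EuclideanSpace ℝ (Fin n)) : inner ℝ x v ≤ gauge K x * inner ℝ a v := by
  by_cases hx : x = 0
  · simp [hx]
  have h := hK.gauge_pos_iff.2 hx
  have h1 := hv _ (hK.gauge_le_one_iff.1 (hK.inv_gauge_smul hx).le)
  rw [inner_sub_left, real_inner_smul_left, sub_nonpos, inv_mul_le_iff₀ h] at h1
  exact h1

theorem inner_pos_of_mem_normalCone (hK : IsBody K) (hv : v ∈ normalCone K a) (hv0 : v ≠ 0) :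
    0 < inner ℝ a v := by
  have h1 := hK.inner_le_of_mem_normalCone hv v
  rw [real_inner_self_eq_norm_sq] at h1
  have h2 : 0 < ‖v‖ ^ 2 := by have := norm_pos_iff.2 hv0; positivity
  exact (pos_iff_pos_of_mul_pos (h2.trans_le h1)).1 (hK.gauge_pos_iff.2 hv0)

theorem inner_nonneg_of_mem_normalCone (hK : IsBody K) (hv : v ∈ normalCone K a) :
    0 ≤ inner ℝ a v := by
  by_cases hv0 : v = 0
  · simp [hv0]
  · exact (hK.inner_pos_of_mem_normalCone hv hv0).le

/-- On the normal cone at `a` the gauge of the polar body is the linear function `⟨a, ·⟩`. -/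
theorem polarGauge_eq (hK : IsBody K) (ha : a ∈ K) (hv : v ∈ normalCone K a) (hv0 : v ≠ 0) :
    polarGauge K v = inner ℝ a v := by
  have hpos := hK.inner_pos_of_mem_normalCone hv hv0
  have h1 : IsLeast {r : ℝ | 0 < r ∧ r⁻¹ • v ∈ polarBody K} (inner ℝ a v) := by
    refine ⟨⟨hpos, fun y hy => ?_⟩, ?_⟩
    · have h2 := hv y hy
      rw [inner_sub_left, sub_nonpos] at h2
      rw [real_inner_smul_left, inv_mul_le_iff₀ hpos, mul_one, real_inner_comm]
      exact h2
    · rintro r ⟨hr, h⟩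
      have h2 := h a ha
      rwa [real_inner_smul_left, inv_mul_le_iff₀ hr, mul_one, real_inner_comm] at h2
  rw [polarGauge, gauge_def']
  exact h1.csInf_eq

theorem hasGradientAt_polarGauge (hK : IsBody K) (ha : a ∈ K) (hv : v ∈ interior (normalCone K a))
    (hv0 : v ≠ 0) : HasGradientAt (polarGauge K) a v := by
  have h1 : HasGradientAt (fun w => inner ℝ a w) a v := by
    rw [hasGradientAt_iff_hasFDerivAt]
    exact (InnerProductSpace.toDual ℝ (EuclideanSpace ℝ (Fin n)) a).hasFDerivAt
  refine h1.congr_of_eventuallyEq ?_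
  filter_upwards [mem_interior_iff_mem_nhds.1 hv, isOpen_ne.mem_nhds hv0] with w hw hw0
  exact hK.polarGauge_eq ha hw hw0

end IsBody

/-- A point of `K` at which some vector is normal coincides with `a` as soon as that vector is
interior to the normal cone at `a`. -/
theorem eq_of_mem_interior_normalCone {b : EuclideanSpace ℝ (Fin n)} (ha : a ∈ K) (hb : b ∈ K)
    (hv : v ∈ interior (normalCone K a)) (hvb : v ∈ normalCone K b) : b = a := by
  have h1 : Tendsto (fun t : ℝ => v + t • (b - a)) (𝓝[>] 0) (𝓝 v) := by
    have : Continuous (fun t : ℝ => v + t • (b - a)) := by fun_prop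
    have h3 := this.tendsto 0
    simp only [zero_smul, add_zero] at h3
    exact h3.mono_left nhdsWithin_le_nhds
  obtain ⟨t, ht, ht0⟩ := ((h1.eventually (mem_interior_iff_mem_nhds.1 hv)).and
    (self_mem_nhdsWithin (s := Ioi (0 : ℝ)))).exists
  have h2 := ht b hb
  have h3 := hvb a ha
  rw [inner_add_right, real_inner_smul_right, real_inner_self_eq_norm_sq] at h2
  rw [← neg_sub, inner_neg_left] at h3
  have h4 : t * ‖b - a‖ ^ 2 ≤ 0 := by linarith
  have h5 : ‖b - a‖ ^ 2 ≤ 0 := nonpos_of_mul_nonpos_right h4 ht0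
  have h6 : ‖b - a‖ = 0 := by
    have := norm_nonneg (b - a)
    exact pow_eq_zero_iff (two_ne_zero) |>.1 (le_antisymm h5 (by positivity))
  exact sub_eq_zero.1 (norm_eq_zero.1 h6)

/-- If `v` is interior to the normal cone at `a`, then the nonnegative function `-⟨·, v⟩` is
coercive on the polar of that cone. -/
theorem exists_coercive (hv : v ∈ interior (normalCone K a)) : ∃ δ : ℝ, 0 < δ ∧ ∀ w,
    (∀ u ∈ normalCone K a, inner ℝ w u ≤ 0) → inner ℝ w v ≤ -δ * ‖w‖ := by
  obtain ⟨δ, hδ, hball⟩ := Metric.mem_nhds_iff.1 (mem_interior_iff_mem_nhds.1 hv)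
  refine ⟨δ / 2, by positivity, fun w hw => ?_⟩
  by_cases hw0 : w = 0
  · simp [hw0]
  have hn : 0 < ‖w‖ := norm_pos_iff.2 hw0
  have h1 := hw (v + (δ / 2 * ‖w‖⁻¹) • w) (hball (by
    rw [Metric.mem_ball, dist_eq_norm, add_sub_cancel_left, norm_smul, Real.norm_eq_abs,
      abs_of_pos (by positivity), mul_assoc, inv_mul_cancel₀ hn.ne']
    linarith))
  rw [inner_add_right, real_inner_smul_right, real_inner_self_eq_norm_sq] at h1
  have h2 : δ / 2 * ‖w‖⁻¹ * ‖w‖ ^ 2 = δ / 2 * ‖w‖ := by field_simp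
  linarith

/-! ### Closest points -/

theorem exists_closest (hK : IsBody K) (hUbdd : Bornology.IsBounded U) (hne : (frontier U).Nonempty)
    (x : EuclideanSpace ℝ (Fin n)) : ∃ y ∈ frontier U, gauge K (x - y) = dist K U x := by
  have hc : IsCompact (frontier U) :=
    hUbdd.isCompact_closure.of_isClosed_subset isClosed_frontier frontier_subset_closure
  have hcont : ContinuousOn (fun y => gauge K (x - y)) (frontier U) :=
    (hK.continuous_gauge.comp (by fun_prop)).continuousOn
  obtain ⟨y, hy, hmin⟩ := hc.exists_sInf_image_eq hne hcont
  exact ⟨y, hy, hmin.symm⟩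

theorem dist_le (hy : y ∈ frontier U) : dist K U x ≤ gauge K (x - y) := by
  refine csInf_le ⟨0, ?_⟩ (mem_image_of_mem _ hy)
  rintro _ ⟨z, -, rfl⟩
  exact gauge_nonneg _

theorem dist_eq_of_forall_le (hy : y ∈ frontier U)
    (h : ∀ w ∈ frontier U, gauge K (x - w) ≤ gauge K (x - y) → w = y) :
    dist K U x = gauge K (x - y) := by
  refine IsLeast.csInf_eq ⟨mem_image_of_mem _ hy, ?_⟩
  rintro _ ⟨w, hw, rfl⟩
  by_contra! hlt
  rw [h w hw hlt.le] at hlt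
  exact lt_irrefl _ hlt

theorem dist_pos (hK : IsBody K) (hUopen : IsOpen U) (hx : x ∈ U) (hy : y ∈ frontier U)
    (hxy : gauge K (x - y) = dist K U x) : 0 < dist K U x := by
  rw [← hxy, hK.gauge_pos_iff, sub_ne_zero]
  rintro rfl
  exact (hUopen.frontier_eq ▸ hy).2 hx

/-- The `K`-ball of radius `ρ(x)` with centre `x ∈ U` lies in `U`: it is connected and does not
meet the boundary. -/
theorem mem_of_gauge_lt_dist (hK : IsBody K) (hUopen : IsOpen U) (hx : x ∈ U)
    {z : EuclideanSpace ℝ (Fin n)} (hz : gauge K (x - z) < dist K U x) : z ∈ U := by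
  have hconv : Convex ℝ {z | gauge K (x - z) < dist K U x} := by
    intro p hp q hq s t hs ht hst
    rw [mem_ofPred_eq] at hp hq ⊢
    have h1 : x - (s • p + t • q) = s • (x - p) + t • (x - q) := by
      have : x = s • x + t • x := by rw [← add_smul, hst, one_smul]
      nth_rewrite 1 [this]
      module
    rw [h1]
    refine (hK.gauge_add_le _ _).trans_lt ?_
    rw [gauge_smul_of_nonneg hs, gauge_smul_of_nonneg ht, smul_eq_mul, smul_eq_mul]
    rcases hs.eq_or_lt with rfl | hs
    · rw [zero_add] at hst
      simpa [hst] using hq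
    · have h2 := mul_lt_mul_of_pos_left hp hs
      have h3 := mul_le_mul_of_nonneg_left hq.le ht
      calc _ < s * dist K U x + t * dist K U x := add_lt_add_of_lt_of_le h2 h3
        _ = dist K U x := by rw [← add_mul, hst, one_mul]
  refine hconv.isPreconnected.subset_left_of_subset_union hUopen isClosed_closure.isOpen_compl
    (disjoint_compl_right.mono_left subset_closure) ?_ ⟨x, ?_, hx⟩ hz
  · intro w hw
    by_contra hcon
    rw [mem_union, not_or, mem_compl_iff, not_not] at hcon
    have hwf : w ∈ frontier U := by rw [hUopen.frontier_eq]; exact ⟨hcon.2, hcon.1⟩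
    exact absurd (dist_le (K := K) (x := x) hwf) (not_le.2 hw)
  · rw [mem_ofPred_eq, sub_self, gauge_zero]
    exact (gauge_nonneg _).trans_lt hz

/-- At a closest point `y` of `x ∈ U`, the inward normal of `U` is normal to `K` at the
normalised direction from `y` to `x`, because the `K`-ball around `x` touches the boundary from
inside at `y`. -/
theorem normal_mem_normalCone (hK : IsBody K) (hUopen : IsOpen U) (hx : x ∈ U)
    (hy : y ∈ frontier U) (hxy : gauge K (x - y) = dist K U x) (hv : IsInwardUnitNormal U y v) :
    v ∈ normalCone K ((dist K U x)⁻¹ • (x - y)) := by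
  have hT := dist_pos hK hUopen hx hy hxy
  set T := dist K U x with hTdef
  set b := T⁻¹ • (x - y) with hb
  have hyb : x - y = T • b := by rw [hb, smul_inv_smul₀ hT.ne']
  have hbK : b ∈ K := by
    rw [← hK.gauge_le_one_iff, hb, gauge_smul_of_nonneg (inv_nonneg.2 hT.le), hxy, smul_eq_mul,
      inv_mul_cancel₀ hT.ne']
  have hint : ∀ w ∈ interior K, inner ℝ (w - b) v ≤ 0 := by
    intro w hw
    by_contra! hpos
    have h1 : inner ℝ (b - w) v < 0 := by rw [← neg_sub, inner_neg_left]; linarith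
    obtain ⟨t, ht, ht0, ht1⟩ := ((hv.2 _).2 h1 |>.and
      (Ioo_mem_nhdsGT hT)).exists
    refine ht (subset_closure (mem_of_gauge_lt_dist hK hUopen hx ?_))
    have h2 : x - (y + t • (b - w)) = T • ((1 - t / T) • b + (t / T) • w) := by
      have h4 : t = T * (t / T) := by field_simp
      rw [← sub_sub, hyb]
      nth_rewrite 1 [h4]
      module
    have h3 : (1 - t / T) • b + (t / T) • w ∈ interior K :=
      hK.convex.combo_self_interior_mem_interior hbK hw
        (sub_nonneg.2 ((div_le_one hT).2 ht1.le)) (div_pos ht0 hT) (by ring)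
    rw [h2, gauge_smul_of_nonneg hT.le, smul_eq_mul]
    have h4 := (gauge_lt_one_iff_mem_interior hK.convex hK.mem_nhds).2 h3
    exact mul_lt_of_lt_one_right hT h4
  intro w hw
  have hcl : w ∈ closure (interior K) := by
    rw [hK.convex.closure_interior_eq_closure_of_nonempty_interior ⟨0, hK.zero_mem⟩]
    exact subset_closure hw
  have hclosed : IsClosed {w : EuclideanSpace ℝ (Fin n) | inner ℝ (w - b) v ≤ 0} :=
    isClosed_le (by fun_prop) continuous_const
  exact closure_minimal hint hclosed hcl

/-- Points of the segment from `x ∈ U` to its unique closest point `y`, other than `y`, lie in `U`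
and have `y` as unique closest point. -/
theorem IsUniqueClosest.of_segment (hK : IsBody K) (hUopen : IsOpen U) (hx : x ∈ U)
    (h : IsUniqueClosest K U x y) {z : EuclideanSpace ℝ (Fin n)} (hz : z ∈ segment ℝ x y)
    (hzy : z ≠ y) : z ∈ U ∧ IsUniqueClosest K U z y := by
  obtain ⟨hy, hxy, huniq⟩ := h
  have hT := dist_pos hK hUopen hx hy hxy
  rw [segment_symm, segment_eq_image'] at hz
  obtain ⟨θ, ⟨hθ0, hθ1⟩, rfl⟩ := hz
  have hθ : 0 < θ := by
    refine hθ0.lt_of_ne ?_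
    rintro rfl
    simp at hzy
  have e1 : gauge K (x - (y + θ • (x - y))) = (1 - θ) * dist K U x := by
    rw [show x - (y + θ • (x - y)) = (1 - θ) • (x - y) by module,
      gauge_smul_of_nonneg (sub_nonneg.2 hθ1), hxy, smul_eq_mul]
  have e2 : gauge K (y + θ • (x - y) - y) = θ * dist K U x := by
    rw [add_sub_cancel_left, gauge_smul_of_nonneg hθ0, hxy, smul_eq_mul]
  have key : ∀ w ∈ frontier U, gauge K (y + θ • (x - y) - w) ≤ gauge K (y + θ • (x - y) - y) →
      w = y := by
    intro w hw hle
    refine huniq w hw (le_antisymm ?_ (dist_le hw))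
    have h1 := hK.gauge_add_le (x - (y + θ • (x - y))) (y + θ • (x - y) - w)
    rw [sub_add_sub_cancel] at h1
    rw [e2] at hle
    linarith
  have hd := dist_eq_of_forall_le hy key
  refine ⟨mem_of_gauge_lt_dist hK hUopen hx ?_, hy, hd.symm, fun w hw hw' => ?_⟩
  · rw [e1]
    nlinarith
  · exact key w hw (hw'.trans hd).le

/-- Closest points depend continuously on `x` where the closest point is unique. -/
theorem eventually_closest_mem (hK : IsBody K) (hUbdd : Bornology.IsBounded U)
    (h : IsUniqueClosest K U x y) {V : Set (EuclideanSpace ℝ (Fin n))} (hV : V ∈ 𝓝 y) :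
    ∀ᶠ x' in 𝓝 x, ∀ y' ∈ frontier U, gauge K (x' - y') = dist K U x' → y' ∈ V := by
  have hc : IsCompact (frontier U \ interior V) :=
    (hUbdd.isCompact_closure.of_isClosed_subset isClosed_frontier frontier_subset_closure).diff
      isOpen_interior
  have hg : Continuous (fun p : EuclideanSpace ℝ (Fin n) × EuclideanSpace ℝ (Fin n) =>
      gauge K (p.1 - p.2)) := hK.continuous_gauge.comp (by fun_prop)
  have hg2 : Continuous (fun p : EuclideanSpace ℝ (Fin n) × EuclideanSpace ℝ (Fin n) =>
      gauge K (p.1 - y)) := hK.continuous_gauge.comp (by fun_prop)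
  -- by compactness, the points of the boundary away from `y` stay farther away than `y`
  have h1 : ∀ᶠ x' in 𝓝 x, ∀ w ∈ frontier U \ interior V, gauge K (x' - y) < gauge K (x' - w) := by
    refine hc.eventually_forall_of_forall_eventually fun w hw => ?_
    refine (isOpen_lt hg2 hg).mem_nhds ?_
    rw [mem_ofPred_eq, h.2.1]
    refine lt_of_le_of_ne (dist_le hw.1) fun heq => hw.2 ?_
    rw [h.2.2 w hw.1 heq.symm]
    exact mem_interior_iff_mem_nhds.2 hV
  filter_upwards [h1] with x' hx' y' hy' heq
  by_contra hcon
  have h2 := hx' y' ⟨hy', fun hint => hcon (interior_subset hint)⟩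
  exact absurd (dist_le (K := K) (x := x') h.1) (not_le.2 (heq ▸ h2))

end Body

/-! ### The signed distance near a boundary point -/

section Core

variable {n : ℕ} {K U : Set (EuclideanSpace ℝ (Fin n))} {a v y : EuclideanSpace ℝ (Fin n)}
  {φ : EuclideanSpace ℝ (Fin n) → ℝ}

/-- Two distinct boundary points near `y` cannot differ by a vector of the polar cone of `N(K, a)`:
such a vector makes an angle bounded away from a right angle with the normal `v` at `y`, whereas
chords of the boundary become tangent to it. -/
theorem eventually_eq_of_polar_cone (h : IsDefiningAt U φ y) (hv : IsInwardUnitNormal U y v)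
    (hvK : v ∈ interior (normalCone K a)) :
    ∀ᶠ p : EuclideanSpace ℝ (Fin n) × EuclideanSpace ℝ (Fin n) in 𝓝 (y, y),
      p.1 ∈ frontier U → p.2 ∈ frontier U →
      (∀ u ∈ normalCone K a, inner ℝ (p.1 - p.2) u ≤ 0) → p.1 = p.2 := by
  obtain ⟨δ, hδ, hcoer⟩ := exists_coercive hvK
  have hg := h.norm_gradient_pos
  have h1 := (h.contDiffAt.hasStrictFDerivAt one_ne_zero).isLittleO.bound
    (show 0 < ‖∇ φ y‖ * δ / 2 by positivity)
  filter_upwards [h1, (continuous_fst.tendsto (y, y)).eventually h.frontier_iff,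
    (continuous_snd.tendsto (y, y)).eventually h.frontier_iff] with p hp hp1 hp2 hf1 hf2 hcone
  have h2 := hcoer _ hcone
  rw [hp1.1 hf1, hp2.1 hf2, h.fderiv_apply hv, sub_zero, zero_sub, norm_neg, Real.norm_eq_abs] at hp
  have h3 := (neg_le_abs _).trans hp
  rw [real_inner_comm] at h3
  have h4 : ‖∇ φ y‖ * (δ * ‖p.1 - p.2‖) ≤ ‖∇ φ y‖ * -inner ℝ (p.1 - p.2) v :=
    mul_le_mul_of_nonneg_left (by linarith) hg.le
  have h5 : ‖∇ φ y‖ * δ / 2 * ‖p.1 - p.2‖ ≤ 0 := by linarith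
  have h6 : ‖p.1 - p.2‖ ≤ 0 := nonpos_of_mul_nonpos_right h5 (by positivity)
  exact sub_eq_zero.1 (norm_le_zero_iff.1 h6)

/-- Moving from the boundary near `y` along a direction transversal to it leads into `U`, or out
of the closure of `U` for negative times. -/
theorem eventually_mem_of_transversal (h : IsDefiningAt U φ y) (ha : 0 < fderiv ℝ φ y a) :
    ∀ᶠ p : EuclideanSpace ℝ (Fin n) × ℝ in 𝓝 (y, 0), p.1 ∈ frontier U →
      (0 < p.2 → p.1 + p.2 • a ∈ U) ∧ (p.2 < 0 → p.1 + p.2 • a ∉ closure U) := by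
  set c := fderiv ℝ φ y a / (‖a‖ + 1) with hc
  have hn := norm_nonneg a
  have hc0 : 0 < c := by positivity
  have hca : c * ‖a‖ < fderiv ℝ φ y a := by
    rw [hc, div_mul_eq_mul_div, div_lt_iff₀ (by positivity)]
    nlinarith
  have h1 := (h.contDiffAt.hasStrictFDerivAt one_ne_zero).isLittleO.bound hc0
  have ht : Tendsto (fun p : EuclideanSpace ℝ (Fin n) × ℝ => p.1 + p.2 • a) (𝓝 (y, 0)) (𝓝 y) := by
    have : Continuous (fun p : EuclideanSpace ℝ (Fin n) × ℝ => p.1 + p.2 • a) := by fun_prop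
    simpa using this.tendsto (y, 0)
  have ht1 : Tendsto (fun p : EuclideanSpace ℝ (Fin n) × ℝ => p.1) (𝓝 (y, 0)) (𝓝 y) :=
    continuous_fst.tendsto (y, (0 : ℝ))
  filter_upwards [(ht.prodMk_nhds ht1).eventually h1, ht1.eventually h.frontier_iff,
    ht.eventually h.mem_iff, ht.eventually h.closure_iff] with p hp hfr hmem hcl hp1
  rw [hfr.1 hp1, add_sub_cancel_left, map_smul, norm_smul, sub_zero, smul_eq_mul, Real.norm_eq_abs,
    Real.norm_eq_abs, abs_le] at hp
  rw [hmem, hcl, not_le]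
  constructor
  · intro hpos
    rw [abs_of_pos hpos] at hp
    nlinarith
  · intro hneg
    rw [abs_of_neg hneg] at hp
    nlinarith

/-- Near `y`, moving from the boundary for a time `t` in the direction `a` leads to a point with
signed distance `t`. For `t > 0` the starting point is its unique closest point. -/
theorem eventually_signedDist_eq (hK : IsBody K) (ha : gauge K a = 1) (h : IsDefiningAt U φ y)
    (hv : IsInwardUnitNormal U y v) (hvK : v ∈ interior (normalCone K a)) :
    ∀ᶠ p : EuclideanSpace ℝ (Fin n) × ℝ in 𝓝 (y, 0), p.1 ∈ frontier U →
      signedDist K U (p.1 + p.2 • a) = p.2 ∧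
      (0 < p.2 → p.1 + p.2 • a ∈ U ∧ IsUniqueClosest K U (p.1 + p.2 • a) p.1) := by
  have hv0 : v ≠ 0 := by rintro rfl; simpa using hv.1
  have hapos : 0 < fderiv ℝ φ y a := by
    rw [h.fderiv_apply hv, real_inner_comm]
    exact mul_pos h.norm_gradient_pos
      (hK.inner_pos_of_mem_normalCone (interior_subset hvK) hv0)
  obtain ⟨R, hR, hnorm⟩ := hK.exists_norm_le
  obtain ⟨ε, hε, hball⟩ := Metric.eventually_nhds_iff_ball.1 (eventually_eq_of_polar_cone h hv hvK)
  have hsmall : ∀ᶠ p : EuclideanSpace ℝ (Fin n) × ℝ in 𝓝 (y, 0),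
      ‖p.1 - y‖ + |p.2| * (‖a‖ + R) < ε := by
    have : Continuous (fun p : EuclideanSpace ℝ (Fin n) × ℝ =>
      ‖p.1 - y‖ + |p.2| * (‖a‖ + R)) := by fun_prop
    exact this.continuousAt.eventually_lt continuousAt_const (by simpa using hε)
  filter_upwards [hsmall, eventually_mem_of_transversal h hapos] with p hp hmem hp1
  obtain ⟨hin, hout⟩ := hmem hp1
  have hsep : ∀ w w', w ∈ frontier U → w' ∈ frontier U → ‖w - y‖ < ε → ‖w' - y‖ < ε →
      (∀ u ∈ normalCone K a, inner ℝ (w - w') u ≤ 0) → w = w' := by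
    intro w w' hw hw' hwε hwε' hcone
    refine hball (w, w') ?_ hw hw' hcone
    rw [← ball_prod_same]
    exact ⟨mem_ball_iff_norm.2 hwε, mem_ball_iff_norm.2 hwε'⟩
  have hpε : ‖p.1 - y‖ < ε := by
    have : 0 ≤ |p.2| * (‖a‖ + R) := by positivity
    linarith
  -- points at `K`-distance at most `|t|` from `p.1 + t • a` are still close to `y`
  have hclose : ∀ w, ‖p.1 + p.2 • a - w‖ ≤ R * |p.2| → ‖w - y‖ < ε := by
    intro w hw
    have h1 : w - y = (p.1 - y) + p.2 • a - (p.1 + p.2 • a - w) := by abel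
    have h2 := norm_sub_le (p.1 - y + p.2 • a) (p.1 + p.2 • a - w)
    have h3 := norm_add_le (p.1 - y) (p.2 • a)
    rw [norm_smul, Real.norm_eq_abs] at h3
    rw [h1]
    linarith
  have hkey : 0 ≤ p.2 → ∀ w ∈ frontier U,
      gauge K (p.1 + p.2 • a - w) ≤ gauge K (p.1 + p.2 • a - p.1) → w = p.1 := by
    intro h0 w hw hle
    rw [add_sub_cancel_left, gauge_smul_of_nonneg h0, ha, smul_eq_mul, mul_one] at hle
    refine (hsep p.1 w hp1 hw hpε (hclose w ?_) fun u hu => ?_).symm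
    · rw [abs_of_nonneg h0]
      exact (hnorm _).trans (mul_le_mul_of_nonneg_left hle hR.le)
    · have h1 := hK.inner_le_of_mem_normalCone hu (p.1 + p.2 • a - w)
      replace h1 := h1.trans
        (mul_le_mul_of_nonneg_right hle (hK.inner_nonneg_of_mem_normalCone hu))
      rw [add_sub_right_comm, inner_add_left, real_inner_smul_left] at h1
      linarith
  have hd : 0 ≤ p.2 → dist K U (p.1 + p.2 • a) = p.2 := by
    intro h0
    rw [dist_eq_of_forall_le hp1 (hkey h0), add_sub_cancel_left, gauge_smul_of_nonneg h0, ha,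
      smul_eq_mul, mul_one]
  refine ⟨?_, fun hpos => ⟨hin hpos, hp1, ?_, fun w hw hw' => hkey hpos.le w hw ?_⟩⟩
  · rcases le_or_gt 0 p.2 with h0 | hneg
    · have hcl : p.1 + p.2 • a ∈ closure U := by
        rcases h0.eq_or_lt with h0 | hpos
        · rw [← h0, zero_smul, add_zero]
          exact frontier_subset_closure hp1
        · exact subset_closure (hin hpos)
      rw [signedDist, if_pos hcl, hd h0]
    · rw [signedDist, if_neg (hout hneg)]
      have e1 : gauge (-K) (p.1 + p.2 • a - p.1) = -p.2 := by
        rw [add_sub_cancel_left, gauge_neg_set_eq_gauge_neg, ← neg_smul,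
          gauge_smul_of_nonneg (by linarith), ha, smul_eq_mul, mul_one]
      rw [dist_eq_of_forall_le hp1 ?_, e1, neg_neg]
      intro w hw hle
      rw [e1, gauge_neg_set_eq_gauge_neg, neg_sub] at hle
      refine hsep w p.1 hw hp1 (hclose w ?_) hpε fun u hu => ?_
      · rw [abs_of_neg hneg, ← norm_neg, neg_sub]
        exact (hnorm _).trans (mul_le_mul_of_nonneg_left hle hR.le)
      · have h1 := hK.inner_le_of_mem_normalCone hu (w - (p.1 + p.2 • a))
        replace h1 := h1.trans
          (mul_le_mul_of_nonneg_right hle (hK.inner_nonneg_of_mem_normalCone hu))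
        rw [← sub_sub, inner_sub_left, real_inner_smul_left] at h1
        linarith
  · rw [dist_eq_of_forall_le hp1 (hkey hpos.le)]
  · rw [hw', dist_eq_of_forall_le hp1 (hkey hpos.le)]

end Core

/-! ### The Euclidean distance near the boundary of a `C²` domain -/

section Euclidean

variable {n : ℕ} {U : Set (EuclideanSpace ℝ (Fin n))} {x y : EuclideanSpace ℝ (Fin n)}
  {φ : EuclideanSpace ℝ (Fin n) → ℝ} {ν : EuclideanSpace ℝ (Fin n) → EuclideanSpace ℝ (Fin n)}

theorem isBody_closedBall : IsBody (Metric.closedBall (0 : EuclideanSpace ℝ (Fin n)) 1) :=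
  ⟨isCompact_closedBall _ _, convex_closedBall _ _,
    by rw [interior_closedBall _ one_ne_zero]; exact Metric.mem_ball_self one_pos⟩

theorem dist_closedBall (hUbdd : Bornology.IsBounded U) (hne : (frontier U).Nonempty)
    (x : EuclideanSpace ℝ (Fin n)) :
    dist (Metric.closedBall 0 1) U x = Metric.infDist x (frontier U) := by
  have hg : ∀ z : EuclideanSpace ℝ (Fin n), gauge (Metric.closedBall 0 1) z = ‖z‖ := fun z => by
    rw [gauge_closedBall zero_le_one, div_one]
  obtain ⟨z, hz, hz'⟩ := exists_closest isBody_closedBall hUbdd hne x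
  refine le_antisymm ?_ ?_
  · refine (Metric.le_infDist hne).2 fun w hw => ?_
    rw [dist_eq_norm, ← hg]
    exact dist_le hw
  · rw [← hz', hg, ← dist_eq_norm]
    exact Metric.infDist_le_dist_of_mem hz

/-- A point of `U` lies on the inward normal line through each of its Euclidean closest points. -/
theorem exists_eq_add_infDist_smul_normal (hUopen : IsOpen U) (hUbdd : Bornology.IsBounded U)
    (hν : ∀ y ∈ frontier U, IsInwardUnitNormal U y (ν y)) (hne : (frontier U).Nonempty)
    (hx : x ∈ U) : ∃ z ∈ frontier U, ‖x - z‖ = Metric.infDist x (frontier U) ∧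
      x = z + Metric.infDist x (frontier U) • ν z := by
  obtain ⟨z, hz, hxz⟩ := exists_closest isBody_closedBall hUbdd hne x
  have hpos := dist_pos isBody_closedBall hUopen hx hz hxz
  have hmem := normal_mem_normalCone isBody_closedBall hUopen hx hz hxz (hν z hz)
  rw [gauge_closedBall zero_le_one, div_one] at hxz
  rw [dist_closedBall hUbdd hne] at hmem hpos hxz
  set D := Metric.infDist x (frontier U)
  have hν1 := (hν z hz).1
  have h1 := hmem (ν z) (mem_closedBall_zero_iff.2 hν1.le)
  have hb : ‖D⁻¹ • (x - z)‖ = 1 := by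
    rw [norm_smul, hxz, norm_inv, Real.norm_of_nonneg hpos.le, inv_mul_cancel₀ hpos.ne']
  rw [inner_sub_left, real_inner_self_eq_norm_sq, hν1] at h1
  have h2 : D⁻¹ • (x - z) = ν z := by
    refine (inner_eq_one_iff_of_norm_eq_one (𝕜 := ℝ) hb hν1).1 (le_antisymm ?_ (by linarith))
    simpa [hb, hν1] using real_inner_le_norm (D⁻¹ • (x - z)) (ν z)
  refine ⟨z, hz, hxz, ?_⟩
  rw [← h2, smul_inv_smul₀ hpos.ne', add_sub_cancel]

/-- Near a boundary point of a `C²` domain the Euclidean distance to the boundary is the restriction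
to the closure of the domain of a `C²` function, whose gradient on the boundary is the inward
normal. With `N = ∇φ / |∇φ|`, the function is `x ↦ t` where `(q, t)` is the preimage of `(x, 0)`
near `(y, 0)` under `(q, t) ↦ (q + t N(q), φ(q))`. Its gradient at `x` is `N(q)`, so it is
one order smoother than the inverse itself. -/
theorem exists_contDiffAt_eq_infDist (hUopen : IsOpen U) (hUbdd : Bornology.IsBounded U)
    (hν : ∀ y ∈ frontier U, IsInwardUnitNormal U y (ν y)) (hy : y ∈ frontier U)
    (h : IsDefiningAt U φ y) (hφ : ContDiffAt ℝ 2 φ y) :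
    ∃ d : EuclideanSpace ℝ (Fin n) → ℝ, ContDiffAt ℝ 2 d y ∧
      (∀ᶠ x in 𝓝 y, x ∈ closure U → Metric.infDist x (frontier U) = d x) ∧
      ∀ᶠ x in 𝓝 y, x ∈ frontier U → ∇ d x = ν x := by
  set N : EuclideanSpace ℝ (Fin n) → EuclideanSpace ℝ (Fin n) :=
    fun q => ‖∇ φ q‖⁻¹ • ∇ φ q with hN
  have hgC : ContDiffAt ℝ 1 (∇ φ) y := hφ.gradient (by norm_num)
  have hg0 : ∇ φ y ≠ 0 := gradient_ne_zero_iff.2 h.fderiv_ne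
  have hNC : ContDiffAt ℝ 1 N y := ((hgC.norm ℝ hg0).inv (norm_ne_zero_iff.2 hg0)).smul hgC
  have hNnorm : ∀ᶠ q in 𝓝 y, ‖N q‖ = 1 := by
    filter_upwards [hgC.continuousAt.eventually_ne hg0] with q hq
    exact norm_smul_inv_norm (𝕜 := ℝ) hq
  have hNν : ∀ᶠ q in 𝓝 y, q ∈ frontier U → N q = ν q := by
    filter_upwards [h.eventually] with q hq hqf
    exact ((hq hqf).normal_eq (hν q hqf)).symm
  set G : EuclideanSpace ℝ (Fin n) × ℝ → EuclideanSpace ℝ (Fin n) × ℝ :=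
    fun p => (p.1 + p.2 • N p.1, φ p.1) with hG
  have hGC : ContDiffAt ℝ 1 G (y, 0) := by
    have h1 : ContDiffAt ℝ 1 (fun p : EuclideanSpace ℝ (Fin n) × ℝ => N p.1) (y, 0) :=
      ContDiffAt.comp (g := N) (y, (0 : ℝ)) hNC contDiffAt_fst
    have h2 : ContDiffAt ℝ 1 (fun p : EuclideanSpace ℝ (Fin n) × ℝ => φ p.1) (y, 0) :=
      ContDiffAt.comp (g := φ) (y, (0 : ℝ)) h.contDiffAt contDiffAt_fst
    exact (contDiffAt_fst.add (contDiffAt_snd.smul h1)).prodMk h2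
  have hG0 : G (y, 0) = (y, 0) := by simp [hG, h.eq_zero]
  have hφN : fderiv ℝ φ y (N y) = ‖∇ φ y‖ := by
    rw [hN]
    simp only
    rw [map_smul, ← inner_gradient_eq, real_inner_self_eq_norm_sq, smul_eq_mul]
    field_simp
  -- the derivative of `G` is injective: on its kernel, `w + s N = 0` and `Dφ w = 0`
  have hinj : Function.Injective (fderiv ℝ G (y, 0)).toLinearMap := by
    rw [injective_iff_map_eq_zero]
    rintro ⟨w, s⟩ hws
    have hN' := (hNC.differentiableAt (by simp)).hasFDerivAt
    have hd : HasFDerivAt G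
        (((ContinuousLinearMap.fst ℝ (EuclideanSpace ℝ (Fin n)) ℝ) +
          ((0 : ℝ) • (fderiv ℝ N y ∘L ContinuousLinearMap.fst ℝ (EuclideanSpace ℝ (Fin n)) ℝ) +
            (ContinuousLinearMap.snd ℝ (EuclideanSpace ℝ (Fin n)) ℝ).smulRight (N y))).prod
        (fderiv ℝ φ y ∘L ContinuousLinearMap.fst ℝ (EuclideanSpace ℝ (Fin n)) ℝ)) (y, 0) := by
      have h1 : HasFDerivAt (fun p : EuclideanSpace ℝ (Fin n) × ℝ => N p.1)
          (fderiv ℝ N y ∘L ContinuousLinearMap.fst ℝ (EuclideanSpace ℝ (Fin n)) ℝ) (y, 0) :=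
        HasFDerivAt.comp (g := N) (y, (0 : ℝ)) hN' hasFDerivAt_fst
      have h2 : HasFDerivAt (fun p : EuclideanSpace ℝ (Fin n) × ℝ => p.2)
          (ContinuousLinearMap.snd ℝ (EuclideanSpace ℝ (Fin n)) ℝ) (y, 0) := hasFDerivAt_snd
      refine (hasFDerivAt_fst.fun_add (h2.fun_smul h1)).prodMk ?_
      · exact HasFDerivAt.comp (g := φ) (y, (0 : ℝ))
          (h.contDiffAt.differentiableAt (by simp)).hasFDerivAt hasFDerivAt_fst
    rw [hd.fderiv] at hws
    simp only [ContinuousLinearMap.coe_coe, ContinuousLinearMap.prod_apply, Prod.mk_eq_zero,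
      add_apply, ContinuousLinearMap.comp_apply, ContinuousLinearMap.coe_fst',
      ContinuousLinearMap.coe_snd', ContinuousLinearMap.smulRight_apply, smul_apply, zero_smul,
      zero_add] at hws
    obtain ⟨h1, h2⟩ := hws
    have h3 := congrArg (fderiv ℝ φ y) h1
    rw [map_add, map_smul, h2, hφN, map_zero, zero_add, smul_eq_mul] at h3
    have h4 : s = 0 := (mul_eq_zero.1 h3).resolve_right h.norm_gradient_pos.ne'
    rw [h4, zero_smul, add_zero] at h1
    rw [h1, h4, Prod.mk_zero_zero]
  set G' : (EuclideanSpace ℝ (Fin n) × ℝ) ≃L[ℝ] (EuclideanSpace ℝ (Fin n) × ℝ) :=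
    (LinearEquiv.ofInjectiveEndo _ hinj).toContinuousLinearEquiv with hG'
  have hGd : HasFDerivAt G (G' : _ →L[ℝ] (EuclideanSpace ℝ (Fin n) × ℝ)) (y, 0) := by
    have : (G' : _ →L[ℝ] (EuclideanSpace ℝ (Fin n) × ℝ)) = fderiv ℝ G (y, 0) := by
      ext <;> rfl
    rw [this]
    exact (hGC.differentiableAt (by simp)).hasFDerivAt
  have hGs := hGC.hasStrictFDerivAt' hGd one_ne_zero
  set I := hGs.localInverse G G' (y, 0)
  have hIC : ContDiffAt ℝ 1 I (y, 0) := by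
    have := hGC.to_localInverse hGd one_ne_zero
    rwa [hG0] at this
  have hIr : ∀ᶠ p in 𝓝 (y, (0 : ℝ)), G (I p) = p := by
    have := hGs.eventually_right_inverse
    rwa [hG0] at this
  have hIl : ∀ᶠ p in 𝓝 (y, (0 : ℝ)), I (G p) = p := hGs.eventually_left_inverse
  have hslice : Tendsto (fun x : EuclideanSpace ℝ (Fin n) => (x, (0 : ℝ))) (𝓝 y) (𝓝 (y, 0)) :=
    (by fun_prop : Continuous fun x : EuclideanSpace ℝ (Fin n) => (x, (0 : ℝ))).tendsto y
  have hI0 : I (y, 0) = (y, 0) := by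
    have := hIl.self_of_nhds
    rwa [hG0] at this
  set J : EuclideanSpace ℝ (Fin n) → EuclideanSpace ℝ (Fin n) × ℝ := fun x => I (x, 0) with hJ
  have hJy : J y = (y, 0) := hI0
  have hJC : ContDiffAt ℝ 1 J y :=
    ContDiffAt.comp (g := I) y hIC (contDiffAt_id.prodMk contDiffAt_const)
  have hqC : ContDiffAt ℝ 1 (fun x => (J x).1) y := hJC.fst
  have htC : ContDiffAt ℝ 1 (fun x => (J x).2) y := hJC.snd
  have hq : Tendsto (fun x => (J x).1) (𝓝 y) (𝓝 y) := by
    have := hqC.continuousAt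
    rwa [ContinuousAt, hJy] at this
  have hJr : ∀ᶠ x in 𝓝 y, (J x).1 + (J x).2 • N (J x).1 = x ∧ φ (J x).1 = 0 := by
    filter_upwards [hslice.eventually hIr] with x hx
    exact Prod.ext_iff.1 hx
  have hJf : ∀ᶠ x in 𝓝 y, x ∈ frontier U → J x = (x, 0) := by
    filter_upwards [hslice.eventually hIl, h.frontier_iff] with x hx hfx hxf
    have : G (x, 0) = (x, 0) := by simp [hG, hfx.1 hxf]
    rwa [this] at hx
  have hgrad : ∀ᶠ x in 𝓝 y, HasFDerivAt (fun x => (J x).2) (innerSL ℝ (N (J x).1)) x := by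
    filter_upwards [hJr.eventually_nhds, hqC.eventually (by simp), htC.eventually (by simp),
      hq.eventually (hNC.eventually (by simp)), hq.eventually hNnorm.eventually_nhds,
      hq.eventually (h.contDiffAt.eventually (by simp)),
      hq.eventually (hgC.continuousAt.eventually_ne hg0)] with x hx hqx htx hNx hn1 hφx hne
    have hq' := (hqx.differentiableAt (by simp)).hasFDerivAt
    have ht' := (htx.differentiableAt (by simp)).hasFDerivAt
    have hN' := (hNx.differentiableAt (by simp)).hasFDerivAt
    have hφ' := (hφx.differentiableAt (by simp)).hasFDerivAt
    set A := fderiv ℝ (fun x => (J x).1) x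
    set b := fderiv ℝ (fun x => (J x).2) x
    have e1 : HasFDerivAt (fun x => (J x).1 + (J x).2 • N (J x).1)
        (ContinuousLinearMap.id ℝ _) x :=
      (hasFDerivAt_id x).congr_of_eventuallyEq (hx.mono fun z hz => hz.1)
    have e2 := (hq'.fun_add (ht'.fun_smul (HasFDerivAt.comp (g := N) x hN' hq'))).unique e1
    have e3 : HasFDerivAt (φ ∘ fun x => (J x).1) (0 : EuclideanSpace ℝ (Fin n) →L[ℝ] ℝ) x :=
      (hasFDerivAt_const (0 : ℝ) x).congr_of_eventuallyEq (hx.mono fun z hz => hz.2)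
    have e4 := (hφ'.comp x hq').unique e3
    -- `N` has constant norm, so it is orthogonal to its derivative
    have e5 : ∀ w, inner ℝ (N (J x).1) (fderiv ℝ N (J x).1 w) = 0 := by
      intro w
      have e6 : HasFDerivAt (fun q => ‖N q‖ ^ 2) (0 : EuclideanSpace ℝ (Fin n) →L[ℝ] ℝ) (J x).1 := by
        refine (hasFDerivAt_const (1 : ℝ) _).congr_of_eventuallyEq (hn1.mono fun q hq => ?_)
        simp only [hq, one_pow]
      have e7 := DFunLike.congr_fun (hN'.norm_sq.unique e6) w
      simpa using e7
    suffices hb : innerSL ℝ (N (J x).1) = b by rwa [hb]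
    refine ContinuousLinearMap.ext fun w => ?_
    have e8 := DFunLike.congr_fun e2 w
    simp only [add_apply, smul_apply, ContinuousLinearMap.comp_apply,
      ContinuousLinearMap.smulRight_apply, ContinuousLinearMap.id_apply, Function.comp_apply] at e8
    have e9 : inner ℝ (N (J x).1) (A w) = 0 := by
      have := DFunLike.congr_fun e4 w
      rw [ContinuousLinearMap.comp_apply, ← inner_gradient_eq, zero_apply] at this
      rw [hN]
      simp only
      rw [real_inner_smul_left, this, mul_zero]
    rw [innerSL_apply_apply]
    conv_lhs => rw [← e8]
    rw [inner_add_right, inner_add_right, real_inner_smul_right, real_inner_smul_right, e9, e5,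
      real_inner_self_eq_norm_sq, hn1.self_of_nhds]
    ring
  refine ⟨fun x => (J x).2, ?_, ?_, ?_⟩
  · have h1 : ContDiffAt ℝ (1 : ℕ) (fun x => innerSL ℝ (N (J x).1)) y := by
      refine (innerSL ℝ).contDiff.contDiffAt.comp y ?_
      refine ContDiffAt.comp (g := N) y ?_ hqC
      rw [hJy]
      exact_mod_cast hNC
    have := contDiffAt_succ_iff_hasFDerivAt.2 ⟨_, ⟨_, hgrad, fun x hx => hx⟩, h1⟩
    exact_mod_cast this
  · obtain ⟨ε, hε, hball⟩ := Metric.eventually_nhds_iff_ball.1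
      (hIl.and ((continuous_fst.tendsto (y, (0 : ℝ))).eventually (hNν.and h.frontier_iff)))
    filter_upwards [hJf, Metric.ball_mem_nhds y (half_pos hε)] with x hxf hxε hxc
    by_cases hxU : x ∈ U
    · obtain ⟨z, hz, hxz, hxeq⟩ := exists_eq_add_infDist_smul_normal hUopen hUbdd hν ⟨y, hy⟩ hxU
      set D := Metric.infDist x (frontier U) with hD
      rw [mem_ball_iff_norm] at hxε
      have hDε : D < ε / 2 := by
        refine (Metric.infDist_le_dist_of_mem hy).trans_lt ?_
        rwa [dist_eq_norm]
      have hzε : ‖z - y‖ < ε := by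
        have := norm_sub_le (x - y) (x - z)
        rw [sub_sub_sub_cancel_left] at this
        linarith
      have hmem : ((z, D) : EuclideanSpace ℝ (Fin n) × ℝ) ∈ Metric.ball (y, (0 : ℝ)) ε := by
        rw [← ball_prod_same]
        refine ⟨mem_ball_iff_norm.2 hzε, ?_⟩
        rw [mem_ball_iff_norm, sub_zero, Real.norm_of_nonneg Metric.infDist_nonneg]
        linarith
      obtain ⟨h1, h2, h3⟩ := hball _ hmem
      have h4 : G (z, D) = (x, 0) := by
        rw [hG]
        simp only
        rw [h2 hz, h3.1 hz, ← hxeq]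
      rw [h4] at h1
      rw [hJ]
      simp only [h1]
    · have hfr : x ∈ frontier U := by rw [hUopen.frontier_eq]; exact ⟨hxc, hxU⟩
      rw [hxf hfr, Metric.infDist_zero_of_mem hfr]
  · filter_upwards [hgrad, hJf, hNν] with x h1 h2 h3 hxf
    rw [← h3 hxf]
    rw [h2 hxf] at h1
    refine HasGradientAt.gradient ?_
    rw [hasGradientAt_iff_hasFDerivAt]
    exact h1

end Euclidean

/-! ### Derivatives of the signed distance -/

section Derivatives

variable {n : ℕ} {K U S : Set (EuclideanSpace ℝ (Fin n))} {a v x y : EuclideanSpace ℝ (Fin n)}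
  {φ d f g : EuclideanSpace ℝ (Fin n) → ℝ} {k : ℕ} {α : ℝ≥0}
  {ν : EuclideanSpace ℝ (Fin n) → EuclideanSpace ℝ (Fin n)}

/-- The second derivative relative to `S` is the ordinary second derivative of any `C²` function
that coincides with the given one on `S` near the point. -/
theorem hessWithin_eq_fderiv_gradient (hS : UniqueDiffOn ℝ S) (hx : x ∈ S)
    (hfg : ∀ᶠ z in 𝓝 x, z ∈ S → f z = g z) (hg : ContDiffAt ℝ 2 g x) :
    hessWithin f S x = fderiv ℝ (∇ g) x := by
  have hfg' : f =ᶠ[𝓝[S] x] g := eventually_nhdsWithin_iff.2 hfg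
  have h1 : gradientWithin f S =ᶠ[𝓝[S] x] ∇ g := by
    have h2 : ∀ᶠ z in 𝓝[S] x, ContDiffAt ℝ 2 g z :=
      nhdsWithin_le_nhds (hg.eventually (by simp))
    filter_upwards [hfg'.fderivWithin (𝕜 := ℝ), h2, self_mem_nhdsWithin] with z hz hgz hzS
    rw [gradientWithin, gradient, hz,
      (hgz.differentiableAt (by simp)).fderivWithin (hS z hzS)]
  have h3 : DifferentiableAt ℝ (∇ g) x :=
    (hg.gradient (m := 1) (by norm_num)).differentiableAt (by simp)
  rw [hessWithin]
  change fderivWithin ℝ (gradientWithin f S) S x = _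
  rw [h1.fderivWithin_eq (h1.self_of_nhdsWithin hx), h3.fderivWithin (hS x hx)]

theorem fderiv_gradient_translate (g : EuclideanSpace ℝ (Fin n) → ℝ) (b : EuclideanSpace ℝ (Fin n))
    (c : ℝ) (x : EuclideanSpace ℝ (Fin n)) :
    fderiv ℝ (∇ (fun z => g (z - b) + c)) x = fderiv ℝ (∇ g) (x - b) := by
  have h1 : ∇ (fun z => g (z - b) + c) = fun z => ∇ g (z - b) := by
    funext z
    rw [gradient, fderiv_add_const, fderiv_comp_sub, gradient]
  rw [h1, fderiv_comp_sub]

theorem dist_eq_signedDist (hx : x ∈ closure U) : dist K U x = signedDist K U x := by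
  rw [signedDist, if_pos hx]

theorem IsDefiningAt.eventually_normal_mem (h : IsDefiningAt U φ y) (hy : y ∈ frontier U)
    (hν : ∀ y ∈ frontier U, IsInwardUnitNormal U y (ν y)) {V : Set (EuclideanSpace ℝ (Fin n))}
    (hV : IsOpen V) (hyV : ν y ∈ V) : ∀ᶠ z in 𝓝 y, z ∈ frontier U → ν z ∈ V := by
  have hg : ContinuousAt (∇ φ) y := (h.contDiffAt.gradient (m := 0) (by simp)).continuousAt
  have hN : ContinuousAt (fun z => ‖∇ φ z‖⁻¹ • ∇ φ z) y :=
    (hg.norm.inv₀ h.norm_gradient_pos.ne').smul hg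
  rw [h.normal_eq (hν y hy)] at hyV
  filter_upwards [hN.eventually (hV.mem_nhds hyV), h.eventually] with z hz hzd hzf
  rw [(hzd hzf).normal_eq (hν z hzf)]
  exact hz

/-- Near `y` the signed distance is the implicit function of the boundary in the direction `a`.
Hence it is as regular as the boundary, and its gradient at `x` is the normal at the projection
`x - ρ_s(x) a` of `x` to the boundary, divided by its component along `a`. -/
theorem ckHolderAt_signedDist (hK : IsBody K) (ha : gauge K a = 1) (hα : α ≤ 1) (hk : 1 ≤ k)
    (hφ : CkHolderAt k α φ y) (h : IsDefiningAt U φ y) (hy : y ∈ frontier U)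
    (hν : ∀ y ∈ frontier U, IsInwardUnitNormal U y (ν y))
    (hvK : ν y ∈ interior (normalCone K a)) :
    CkHolderAt k α (signedDist K U) y ∧ ∀ᶠ x in 𝓝 y, x - signedDist K U x • a ∈ frontier U ∧
      HasGradientAt (signedDist K U) ((inner ℝ a (ν (x - signedDist K U x • a)))⁻¹ •
        ν (x - signedDist K U x • a)) x := by
  have hv0 : ν y ≠ 0 := by intro h0; simpa [h0] using (hν y hy).1
  have hapos : 0 < fderiv ℝ φ y a := by
    rw [h.fderiv_apply (hν y hy), real_inner_comm]
    exact mul_pos h.norm_gradient_pos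
      (hK.inner_pos_of_mem_normalCone (interior_subset hvK) hv0)
  obtain ⟨τ, hτ0, hτ, hτφ, hτd⟩ := exists_implicit hα hk hφ h.eq_zero hapos.ne'
  have hτc : Tendsto τ (𝓝 y) (𝓝 0) := by simpa [ContinuousAt, hτ0] using hτ.1.continuousAt
  have hp : Tendsto (fun x => x - τ x • a) (𝓝 y) (𝓝 y) := by
    simpa using tendsto_id.sub (hτc.smul (tendsto_const_nhds (x := a)))
  have heq : signedDist K U =ᶠ[𝓝 y] τ := by
    filter_upwards [(hp.prodMk_nhds hτc).eventually (eventually_signedDist_eq hK ha h (hν y hy) hvK),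
      hp.eventually h.frontier_iff, hτφ] with x h1 h2 h3
    have := (h1 (h2.2 h3)).1
    rwa [sub_add_cancel] at this
  refine ⟨hτ.congr heq, ?_⟩
  filter_upwards [heq.eventually_nhds, hτd, hτφ, hp.eventually h.frontier_iff,
    hp.eventually h.eventually] with x h1 h2 h3 h4 h5
  rw [h1.self_of_nhds]
  have hpf := h4.2 h3
  refine ⟨hpf, HasGradientAt.congr_of_eventuallyEq ?_ h1⟩
  rw [hasGradientAt_iff_hasFDerivAt]
  convert! h2 using 1
  refine ContinuousLinearMap.ext fun w => ?_
  have h6 := (h5 hpf).norm_gradient_pos.ne'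
  rw [InnerProductSpace.toDual_apply_apply, smul_apply, (h5 hpf).fderiv_apply (hν _ hpf),
    (h5 hpf).fderiv_apply (hν _ hpf), real_inner_smul_left, real_inner_comm _ a, smul_eq_mul,
    mul_inv, mul_mul_mul_comm, inv_mul_cancel₀ h6, one_mul]

/-- The second derivative of the signed distance on the boundary, obtained by differentiating the
formula for its gradient. -/
theorem fderiv_gradient_signedDist (hK : IsBody K) (ha : gauge K a = 1) (hy : y ∈ frontier U)
    (hv : IsInwardUnitNormal U y (ν y)) (hvK : ν y ∈ interior (normalCone K a))
    (hy0 : signedDist K U y = 0)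
    (hgrad : ∀ᶠ x in 𝓝 y, x - signedDist K U x • a ∈ frontier U ∧
      HasGradientAt (signedDist K U) ((inner ℝ a (ν (x - signedDist K U x • a)))⁻¹ •
        ν (x - signedDist K U x • a)) x)
    (hd : ContDiffAt ℝ 2 d y) (hdν : ∀ᶠ x in 𝓝 y, x ∈ frontier U → ∇ d x = ν x) :
    fderiv ℝ (∇ (signedDist K U)) y = (1 / polarGauge K (ν y)) •
      ((ContinuousLinearMap.id ℝ (EuclideanSpace ℝ (Fin n)) -
          ContinuousLinearMap.adjoint (projX K (ν y))) ∘L fderiv ℝ (∇ d) y ∘L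
        (ContinuousLinearMap.id ℝ (EuclideanSpace ℝ (Fin n)) - projX K (ν y))) := by
  have hv0 : ν y ≠ 0 := by intro h0; simpa [h0] using hv.1
  have haK : a ∈ K := hK.gauge_le_one_iff.1 ha.le
  have hpos := hK.inner_pos_of_mem_normalCone (interior_subset hvK) hv0
  rw [projX, (hK.hasGradientAt_polarGauge haK hvK hv0).gradient,
    hK.polarGauge_eq haK (interior_subset hvK) hv0]
  set c := inner ℝ a (ν y) with hc
  set p : EuclideanSpace ℝ (Fin n) → EuclideanSpace ℝ (Fin n) :=
    fun x => x - signedDist K U x • a with hp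
  have hpy : p y = y := by simp [hp, hy0]
  have hρ := hgrad.self_of_nhds.2
  change HasGradientAt (signedDist K U) ((inner ℝ a (ν (p y)))⁻¹ • ν (p y)) y at hρ
  rw [hpy, ← hc, hasGradientAt_iff_hasFDerivAt] at hρ
  have hpd : HasFDerivAt p (ContinuousLinearMap.id ℝ _ -
      ((InnerProductSpace.toDual ℝ (EuclideanSpace ℝ (Fin n))) (c⁻¹ • ν y)).smulRight a) y :=
    (hasFDerivAt_id y).fun_sub (hρ.smul_const a)
  have hM := ((hd.gradient (m := 1) (by norm_num)).differentiableAt (by simp)).hasFDerivAt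
  have hMp : HasFDerivAt (fun x => ∇ d (p x)) (fderiv ℝ (∇ d) y ∘L (ContinuousLinearMap.id ℝ _ -
      ((InnerProductSpace.toDual ℝ (EuclideanSpace ℝ (Fin n))) (c⁻¹ • ν y)).smulRight a)) y := by
    rw [← hpy] at hM
    have := HasFDerivAt.comp (g := ∇ d) y hM hpd
    rwa [hpy] at this
  have hcd := ((innerSL ℝ a).hasFDerivAt.comp y hMp)
  have hνy : ∇ d (p y) = ν y := by rw [hpy]; exact hdν.self_of_nhds hy
  have hcy : (innerSL ℝ a) (∇ d (p y)) = c := by rw [hνy, innerSL_apply_apply]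
  have hinv := (hasDerivAt_inv (x := (innerSL ℝ a) (∇ d (p y)))
    (by rw [hcy]; exact hpos.ne')).comp_hasFDerivAt y hcd
  have hfull := hinv.fun_smul hMp
  have heq : ∇ (signedDist K U) =ᶠ[𝓝 y]
      fun x => (Inv.inv ∘ (innerSL ℝ a) ∘ fun x => ∇ d (p x)) x • ∇ d (p x) := by
    have hpt : Tendsto p (𝓝 y) (𝓝 y) := by
      have := hpd.continuousAt
      rwa [ContinuousAt, hpy] at this
    filter_upwards [hgrad, hpt.eventually hdν] with x h1 h2
    rw [h1.2.gradient]
    simp only [Function.comp_apply, innerSL_apply_apply]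
    rw [h2 h1.1]
  rw [heq.fderiv_eq, hfull.fderiv]
  refine ContinuousLinearMap.ext fun w => ?_
  simp only [Function.comp_apply, hνy, add_apply, smul_apply, sub_apply,
    ContinuousLinearMap.comp_apply, ContinuousLinearMap.smulRight_apply,
    ContinuousLinearMap.id_apply, InnerProductSpace.toDual_apply_apply, innerSL_apply_apply,
    map_smulₛₗ, InnerProductSpace.adjoint_rankOne, InnerProductSpace.rankOne_apply,
    smul_eq_mul, one_div, conj_trivial, smul_smul]
  module

end Derivatives

/-! ### Propagation along segments to the closest point -/

section Segment

variable {n : ℕ} {K U : Set (EuclideanSpace ℝ (Fin n))} {a x y z : EuclideanSpace ℝ (Fin n)}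
  {φ : EuclideanSpace ℝ (Fin n) → ℝ}
  {ν : EuclideanSpace ℝ (Fin n) → EuclideanSpace ℝ (Fin n)}

/-- Every point of `U` is reached in the direction `a` from each of its closest points at which
the inward normal is interior to the normal cone at `a`. -/
theorem sub_eq_dist_smul (hK : IsBody K) (ha : a ∈ K) (hUopen : IsOpen U)
    (hν : ∀ y ∈ frontier U, IsInwardUnitNormal U y (ν y)) (hx : x ∈ U) (hy : y ∈ frontier U)
    (hxy : gauge K (x - y) = dist K U x) (hvK : ν y ∈ interior (normalCone K a)) :
    x - y = dist K U x • a := by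
  have hT := dist_pos hK hUopen hx hy hxy
  have hb : (dist K U x)⁻¹ • (x - y) ∈ K := by
    rw [← hK.gauge_le_one_iff, gauge_smul_of_nonneg (inv_nonneg.2 hT.le), hxy, smul_eq_mul,
      inv_mul_cancel₀ hT.ne']
  rw [← eq_of_mem_interior_normalCone ha hb hvK
    (normal_mem_normalCone hK hUopen hx hy hxy (hν y hy)), smul_inv_smul₀ hT.ne']

/-- Near a point `z` with unique closest point `y`, the distance is a translate of the signed
distance near `y`: closest points of points near `z` are near `y`, and they are all left in the
same direction `a`. -/
theorem IsUniqueClosest.eventually_dist_eq (hK : IsBody K) (ha : gauge K a = 1)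
    (hUopen : IsOpen U) (hUbdd : Bornology.IsBounded U)
    (hν : ∀ y ∈ frontier U, IsInwardUnitNormal U y (ν y)) (h : IsDefiningAt U φ y)
    (hvK : ν y ∈ interior (normalCone K a)) (hz : z ∈ U) (hzy : IsUniqueClosest K U z y) :
    ∀ᶠ x in 𝓝 z, dist K U x = signedDist K U (x - (z - y)) + dist K U z := by
  have haK : a ∈ K := hK.gauge_le_one_iff.1 ha.le
  have hzy' := sub_eq_dist_smul hK haK hUopen hν hz hzy.1 hzy.2.1 hvK
  set s := dist K U z with hs
  have ht : Tendsto (fun p : EuclideanSpace ℝ (Fin n) × EuclideanSpace ℝ (Fin n) =>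
      (p.2, gauge K (p.1 - p.2) - s)) (𝓝 (z, y)) (𝓝 (y, 0)) := by
    have hc : Continuous (fun p : EuclideanSpace ℝ (Fin n) × EuclideanSpace ℝ (Fin n) =>
        (p.2, gauge K (p.1 - p.2) - s)) :=
      continuous_snd.prodMk ((hK.continuous_gauge.comp (by fun_prop)).sub continuous_const)
    have := hc.tendsto (z, y)
    simpa only [hzy.2.1, ← hs, sub_self] using this
  have hev := (ht.eventually (eventually_signedDist_eq hK ha h (hν y hzy.1) hvK)).and
    ((continuous_snd.tendsto (z, y)).eventually
      (h.eventually_normal_mem hzy.1 hν isOpen_interior hvK))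
  rw [nhds_prod_eq] at hev
  obtain ⟨A, hA, B, hB, hAB⟩ := Filter.eventually_prod_iff.1 hev
  filter_upwards [hUopen.mem_nhds hz, hA, eventually_closest_mem hK hUbdd hzy hB] with x hxU hxA hxB
  obtain ⟨w, hw, hxw⟩ := exists_closest hK hUbdd ⟨y, hzy.1⟩ x
  obtain ⟨h1, h2⟩ := hAB hxA (hxB w hw hxw)
  have h3 := (h1 hw).1
  have h4 := sub_eq_dist_smul hK haK hUopen hν hxU hw hxw (h2 hw)
  simp only [hxw] at h3
  have h5 : x - (z - y) = w + (dist K U x - s) • a := by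
    rw [hzy', sub_smul, ← h4]
    abel
  rw [h5, h3, sub_add_cancel]

end Segment

/-! ### Regularity on a ball -/

theorem CkHolderAt.exists_mem_nhds {n : ℕ} {f : EuclideanSpace ℝ (Fin n) → ℝ}
    {y : EuclideanSpace ℝ (Fin n)} {k : ℕ} {α : ℝ≥0} (h : CkHolderAt k α f y) :
    ∃ C : ℝ≥0, ∃ s ∈ 𝓝 y, (∀ x ∈ s, ContDiffAt ℝ k f x) ∧
      HolderOnWith C α (iteratedFDeriv ℝ k f) s := by
  obtain ⟨hc, C, s, hs, hC⟩ := h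
  exact ⟨C, _, inter_mem hs (hc.eventually (by simp)), fun x hx => hx.2,
    hC.mono inter_subset_left⟩

/-- The class `C^{k,α}` on a set with unique derivatives can be checked on an extension to a
neighbourhood of the set. -/
theorem isCkHolderOn_of_eqOn {n : ℕ} {f g : EuclideanSpace ℝ (Fin n) → ℝ}
    {S : Set (EuclideanSpace ℝ (Fin n))} {k : ℕ} {α C : ℝ≥0} (hS : UniqueDiffOn ℝ S)
    (hfg : EqOn f g S) (hg : ∀ x ∈ S, ContDiffAt ℝ k g x)
    (hC : HolderOnWith C α (iteratedFDeriv ℝ k g) S) : IsCkHolderOn k α f S := by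
  refine ⟨fun x hx => (hg x hx).contDiffWithinAt.congr hfg (hfg hx), C, fun x hx z hz => ?_⟩
  rw [iteratedFDerivWithin_congr hfg hx, iteratedFDerivWithin_congr hfg hz,
    iteratedFDerivWithin_eq_iteratedFDeriv hS (hg x hx) hx,
    iteratedFDerivWithin_eq_iteratedFDeriv hS (hg z hz) hz]
  exact hC x hx z hz

end MinkowskiDistance

theorem mainTheorem2 {n : ℕ}
    (K U : Set (EuclideanSpace ℝ (Fin n)))
    (hKcompact : IsCompact K) (hKconvex : Convex ℝ K)
    (hK0 : (0 : EuclideanSpace ℝ (Fin n)) ∈ interior K)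
    (hUopen : IsOpen U) (hUbdd : Bornology.IsBounded U)
    (k : ℕ) (hk : 1 ≤ k) (α : ℝ≥0) (hα : α ≤ 1)
    (hU : MinkowskiDistance.HasCkHolderBoundary k α U)
    (ν : EuclideanSpace ℝ (Fin n) → EuclideanSpace ℝ (Fin n))
    (hν : ∀ y ∈ frontier U, MinkowskiDistance.IsInwardUnitNormal U y (ν y))
    (x₀ y₀ : EuclideanSpace ℝ (Fin n)) (hx₀ : x₀ ∈ U)
    (hy₀ : MinkowskiDistance.IsUniqueClosest K U x₀ y₀)
    (hcone : ν y₀ ∈ interior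
      (MinkowskiDistance.normalCone K ((MinkowskiDistance.dist K U x₀)⁻¹ • (x₀ - y₀)))) :
    ∃ r : ℝ, 0 < r ∧
      -- regularity of the signed extension near `y₀`, and of the distance up to the boundary
      MinkowskiDistance.IsCkHolderOn k α (MinkowskiDistance.signedDist K U) (Metric.ball y₀ r) ∧
      MinkowskiDistance.IsCkHolderOn k α (MinkowskiDistance.dist K U)
        (closure U ∩ Metric.ball y₀ r) ∧
      -- boundary points near `y₀` are unique closest points of interior points
      (∀ y ∈ frontier U ∩ Metric.ball y₀ r, ∃ x ∈ U, MinkowskiDistance.IsUniqueClosest K U x y) ∧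
      -- the first derivative on the boundary
      (∀ y ∈ frontier U ∩ Metric.ball y₀ r,
        HasGradientWithinAt (MinkowskiDistance.dist K U)
          ((1 / MinkowskiDistance.polarGauge K (ν y)) • ν y) (closure U) y) ∧
      -- the second derivative
      (2 ≤ k →
        ContDiffOn ℝ 2 (fun x => Metric.infDist x (frontier U)) (closure U ∩ Metric.ball y₀ r) ∧
        ∀ y ∈ frontier U ∩ Metric.ball y₀ r,
          DifferentiableAt ℝ (MinkowskiDistance.polarGauge K) (ν y) ∧
          MinkowskiDistance.hessWithin (MinkowskiDistance.dist K U) (closure U) y =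
            (1 / MinkowskiDistance.polarGauge K (ν y)) •
              ((ContinuousLinearMap.id ℝ (EuclideanSpace ℝ (Fin n)) -
                  ContinuousLinearMap.adjoint (MinkowskiDistance.projX K (ν y))) ∘L
                MinkowskiDistance.hessWithin
                  (fun x => Metric.infDist x (frontier U)) (closure U) y ∘L
                (ContinuousLinearMap.id ℝ (EuclideanSpace ℝ (Fin n)) -
                  MinkowskiDistance.projX K (ν y))) ∧
          -- the second derivative is constant on segments to the unique closest point
          ∀ x ∈ U, MinkowskiDistance.IsUniqueClosest K U x y → ∀ z ∈ segment ℝ x y,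
            ContDiffWithinAt ℝ 2 (MinkowskiDistance.dist K U) (closure U) z ∧
            MinkowskiDistance.hessWithin (MinkowskiDistance.dist K U) (closure U) z =
              MinkowskiDistance.hessWithin (MinkowskiDistance.dist K U) (closure U) y) := by
  open MinkowskiDistance in
  have hK : IsBody K := ⟨hKcompact, hKconvex, hK0⟩
  have hy₀f := hy₀.1
  set a := (MinkowskiDistance.dist K U x₀)⁻¹ • (x₀ - y₀) with ha_def
  have ha : gauge K a = 1 := by
    have hT := dist_pos hK hUopen hx₀ hy₀f hy₀.2.1
    rw [ha_def, gauge_smul_of_nonneg (inv_nonneg.2 hT.le), hy₀.2.1, smul_eq_mul,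
      inv_mul_cancel₀ hT.ne']
  have haK : a ∈ K := hK.gauge_le_one_iff.1 ha.le
  have hS := uniqueDiffOn_closure hUopen hν
  obtain ⟨φ, hφ, hdef⟩ := exists_isDefiningAt hUopen hk hU hy₀f
  obtain ⟨hreg, hgrad⟩ := ckHolderAt_signedDist hK ha hα hk hφ hdef hy₀f hν hcone
  obtain ⟨C, s, hs, hsk, hsC⟩ := hreg.exists_mem_nhds
  -- a `C²` extension of the Euclidean distance, available for `k ≥ 2`
  obtain ⟨d, hd⟩ : ∃ d : EuclideanSpace ℝ (Fin n) → ℝ, ∀ᶠ y in 𝓝 y₀, 2 ≤ k → ContDiffAt ℝ 2 d y ∧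
      (∀ᶠ x in 𝓝 y, x ∈ closure U → Metric.infDist x (frontier U) = d x) ∧
      ∀ᶠ x in 𝓝 y, x ∈ frontier U → ∇ d x = ν x := by
    by_cases h2 : 2 ≤ k
    · obtain ⟨d, h3, h4, h5⟩ := exists_contDiffAt_eq_infDist hUopen hUbdd hν hy₀f hdef
        (hφ.1.of_le (by exact_mod_cast h2))
      refine ⟨d, ?_⟩
      filter_upwards [h3.eventually (by simp), h4.eventually_nhds, h5.eventually_nhds]
        with y h6 h7 h8 _ using ⟨h6, h7, h8⟩
    · exact ⟨0, Eventually.of_forall fun _ h => absurd h h2⟩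
  obtain ⟨r, hr, hball⟩ := Metric.eventually_nhds_iff_ball.1 (((hdef.eventually).and
    (hdef.eventually_normal_mem hy₀f hν isOpen_interior hcone)).and
    ((hgrad.eventually_nhds.and hd).and hs))
  have hdist : ∀ x ∈ closure U,
      MinkowskiDistance.dist K U x = MinkowskiDistance.signedDist K U x :=
    fun x hx => dist_eq_signedDist hx
  have hnear : ∀ y ∈ frontier U ∩ Metric.ball y₀ r, IsDefiningAt U φ y ∧
      ν y ∈ interior (normalCone K a) ∧ MinkowskiDistance.signedDist K U y = 0 := by
    rintro y ⟨hy, hyr⟩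
    have h1 := (hball y hyr).1.1 hy
    have h2 := (hball y hyr).1.2 hy
    refine ⟨h1, h2, ?_⟩
    simpa using ((eventually_signedDist_eq hK ha h1 (hν y hy) h2).self_of_nhds hy).1
  have hpolar : ∀ y ∈ frontier U ∩ Metric.ball y₀ r, ν y ≠ 0 ∧
      MinkowskiDistance.polarGauge K (ν y) = inner ℝ a (ν y) := by
    intro y hy
    have hv0 : ν y ≠ 0 := by intro h0; simpa [h0] using (hν y hy.1).1
    exact ⟨hv0, hK.polarGauge_eq haK (interior_subset (hnear y hy).2.1) hv0⟩
  refine ⟨r, hr, ?_, ?_, ?_, ?_, fun hk2 => ⟨?_, ?_⟩⟩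
  · exact isCkHolderOn_of_eqOn Metric.isOpen_ball.uniqueDiffOn (fun x _ => rfl)
      (fun x hx => hsk x (hball x hx).2.2) (hsC.mono fun x hx => (hball x hx).2.2)
  · exact isCkHolderOn_of_eqOn (hS.inter Metric.isOpen_ball) (fun x hx => hdist x hx.1)
      (fun x hx => hsk x (hball x hx.2).2.2) (hsC.mono fun x hx => (hball x hx.2).2.2)
  · intro y hy
    obtain ⟨h1, h2, -⟩ := hnear y hy
    have ht : Tendsto (fun t : ℝ => (y, t)) (𝓝[>] 0) (𝓝 (y, 0)) :=
      ((by fun_prop : Continuous fun t : ℝ => (y, t)).tendsto 0).mono_left nhdsWithin_le_nhds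
    obtain ⟨t, ht, ht0⟩ := ((ht.eventually
      (eventually_signedDist_eq hK ha h1 (hν y hy.1) h2)).and self_mem_nhdsWithin).exists
    exact ⟨_, (ht hy.1).2 ht0⟩
  · intro y hy
    have h1 := (hball y hy.2).2.1.1.self_of_nhds.2
    rw [(hnear y hy).2.2, zero_smul, sub_zero, ← (hpolar y hy).2, ← one_div] at h1
    have hyc := frontier_subset_closure hy.1
    exact (hasGradientWithinAt_iff_hasFDerivWithinAt.2
      (hasGradientAt_iff_hasFDerivAt.1 h1).hasFDerivWithinAt).congr hdist (hdist y hyc)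
  · rintro x ⟨hx, hxr⟩
    obtain ⟨h1, h2, -⟩ := (hball x hxr).2.1.2 hk2
    refine (h1.contDiffWithinAt.congr_of_eventuallyEq (s := closure U ∩ Metric.ball y₀ r) ?_
      (h2.self_of_nhds hx))
    filter_upwards [nhdsWithin_le_nhds h2, self_mem_nhdsWithin] with z hz hz' using hz hz'.1
  · intro y hy
    obtain ⟨h1, h2, h0⟩ := hnear y hy
    obtain ⟨hd1, hd2, hd3⟩ := (hball y hy.2).2.1.2 hk2
    have hyc := frontier_subset_closure hy.1
    have hC2 : ContDiffAt ℝ 2 (MinkowskiDistance.signedDist K U) y :=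
      (hsk y (hball y hy.2).2.2).of_le (by exact_mod_cast hk2)
    have hhess := hessWithin_eq_fderiv_gradient hS hyc (Eventually.of_forall hdist) hC2
    refine ⟨(hK.hasGradientAt_polarGauge haK h2 (hpolar y hy).1).differentiableAt, ?_, ?_⟩
    · rw [hhess, hessWithin_eq_fderiv_gradient hS hyc hd2 hd1]
      exact fderiv_gradient_signedDist hK ha hy.1 (hν y hy.1) h2 h0 (hball y hy.2).2.1.1 hd1 hd3
    · intro x hx hxy z hz
      -- only `z = y` is a boundary point; elsewhere the distance is a translate near `z`
      by_cases hzy : z = y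
      · subst hzy
        exact ⟨hC2.contDiffWithinAt.congr hdist (hdist z hyc), rfl⟩
      obtain ⟨hzU, hzu⟩ := hxy.of_segment hK hUopen hx hz hzy
      have heq := hzu.eventually_dist_eq hK ha hUopen hUbdd hν h1 h2 hzU
      have hC2z : ContDiffAt ℝ 2 (fun w => MinkowskiDistance.signedDist K U (w - (z - y)) +
          MinkowskiDistance.dist K U z) z := by
        refine ContDiffAt.add ?_ contDiffAt_const
        refine ContDiffAt.comp (g := MinkowskiDistance.signedDist K U) z ?_
          (contDiffAt_id.sub contDiffAt_const)
        simpa using hC2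
      refine ⟨(hC2z.congr_of_eventuallyEq heq).contDiffWithinAt, ?_⟩
      rw [hhess, hessWithin_eq_fderiv_gradient hS (subset_closure hzU)
        (heq.mono fun w hw _ => hw) hC2z, fderiv_gradient_translate, sub_sub_cancel]
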